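/- Let $K$ be a $p$-adic field (a finite extension of $\mathbf{Q}_p$), $\mathcal{O}$ its ring of integers, $\mathfrak{m}$ the maximal ideal, $\mathbf{F}_q=\mathcal{O}/\mathfrak{m}$, and $|\cdot|$ the absolute value on $K$ normalized by $|a|=q^{-v(a)}$. Let $\mathfrak{X}$ be an integral scheme that is projective and smooth of relative dimension $n$ over $\mathcal{O}$, with generic fibre $X$ and special fibre $X_0$; identify $X(K)=\mathfrak{X}(\mathcal{O})$. Let $\mu_{\mathfrak{X}}$ be the canonical measure on $X(K)$: the measure which on each fibre of the reduction map $\mathfrak{X}(\mathcal{O})\to X_0(\mathbf{F}_q)$ corresponds, under local coordinates $u=(u_1,\dots,u_n)$ (regular functions on an affine open of $\mathfrak{X}$ whose differentials form a basis of $\Omega_{\mathfrak{X}/\mathcal{O}}$ there), which identify the fibre with a translate of $\mathfrak{m}^{n}\subset K^n$ (the $n$-fold product of $\mathfrak m$), to the Haar measure on $K^n$ with $\mathcal{O}^n$ of measure $1$. Let $r$ be a positive integer and $\alpha\in H^0\bigl(\mathfrak{X},(\bigwedge^n\Omega_{\mathfrak{X}/\mathcal{O}})^{\otimes r}\bigr)$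 a nonzero pluricanonical $r$-form. For $s\in\mathbf{C}$ with $\operatorname{Re}s\ge 0$ put $$\|\alpha\|_s=\int_{X(K)}|\alpha|^s\,d\mu_{\mathfrak{X}}^{1-rs},$$ where the integrand is $|a(u)|^s\,du$ in such coordinates, if $\alpha=a(u)\,(du_1\wedge\dots\wedge du_n)^{\otimes r}$. For $k\ge1$ let $N_k$ be the number of points $\bar x\in\mathfrak{X}(\mathcal{O}/\mathfrak{m}^k)$ at which the reduction of $\alpha$ modulo $\mathfrak{m}^k$ vanishes, i.e. $\bar x^*\alpha=0$. Then the integral converges absolutely, the series below converges absolutely, and $$\|\alpha\|_s=\frac{\#X_0(\mathbf{F}_q)}{q^n}-(q^s-1)\sum_{k=1}^{\infty}\frac{N_k}{q^{k(n+s)}}.$$ -/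

import Mathlib

open CategoryTheory AlgebraicGeometry MeasureTheory
open scoped TensorProduct ValuativeRel NNReal

universe u

noncomputable section

namespace PluriForm

section Algebra

variable (R A B : Type u) [CommRing R] [CommRing A] [CommRing B]
  [Algebra R A] [Algebra R B] [Algebra A B] [IsScalarTower R A B] (n r : ℕ)

/-- The module `(⋀ⁿ Ω_{A/R})^{⊗ r}` of `r`-canonical forms of an `R`-algebra `A`
of relative dimension `n`. -/
abbrev FormModule : Type u := ⨂[A]^r (⋀[A]^n Ω[A⁄R])

/-- The map `ω₁ ∧ ⋯ ∧ ωₙ ↦ ω₁ ∧ ⋯ ∧ ωₙ` from `⋀ⁿ Ω_{A/R}` to `⋀ⁿ Ω_{B/R}`. -/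
def extMap : (⋀[A]^n Ω[A⁄R]) →ₗ[A] (⋀[B]^n Ω[B⁄R]) :=
  exteriorPower.alternatingMapLinearEquiv
    { toMultilinearMap :=
        ((exteriorPower.ιMulti B n (M := Ω[B⁄R])).toMultilinearMap.restrictScalars
          A).compLinearMap (fun _ => KaehlerDifferential.map R R A B)
      map_eq_zero_of_eq' := fun _ _ _ hv hij =>
        (exteriorPower.ιMulti B n (M := Ω[B⁄R])).map_eq_zero_of_eq _
          (congrArg (KaehlerDifferential.map R R A B) hv) hij }

/-- The pullback of `r`-canonical forms along `A → B`: it sends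
`(a dx₁ ∧ ⋯ ∧ dxₙ) ⊗ ⋯` to its image `(a dx₁ ∧ ⋯ ∧ dxₙ) ⊗ ⋯` over `B`. -/
def formMap : FormModule R A n r →ₗ[A] FormModule R B n r :=
  PiTensorProduct.lift
    (((PiTensorProduct.tprod B (s := fun _ : Fin r => ⋀[B]^n Ω[B⁄R])).restrictScalars
      A).compLinearMap (fun _ => extMap R A B n))

theorem formMap_tprod_ιMulti (v : Fin r → Fin n → Ω[A⁄R]) :
    formMap R A B n r
        (PiTensorProduct.tprod A fun j => exteriorPower.ιMulti A n (v j)) =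
      PiTensorProduct.tprod B fun j =>
        exteriorPower.ιMulti B n fun i => KaehlerDifferential.map R R A B (v j i) := by
  simp only [formMap, PiTensorProduct.lift.tprod, extMap]
  simp only [MultilinearMap.compLinearMap_apply, MultilinearMap.coe_restrictScalars,
    exteriorPower.alternatingMapLinearEquiv_apply_ιMulti]
  rfl

end Algebra

section Scheme

variable {R : Type u} [CommRing R] {X : Scheme.{u}} (f : X ⟶ Spec (.of R))

/-- The ring homomorphism `R → Γ(X, U)` of a scheme `X` over `Spec R`. -/
def toSections (U : X.Opens) : R →+* Γ(X, U) :=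
  ((Scheme.ΓSpecIso (.of R)).inv ≫ f.appLE ⊤ U (show U ≤ f ⁻¹ᵁ ⊤ from le_top)).hom

/-- `Γ(X, U)` as an `R`-algebra. -/
abbrev sectionsAlgebra (U : X.Opens) : Algebra R Γ(X, U) := (toSections f U).toAlgebra

theorem toSections_res {U V : X.Opens} (h : V ≤ U) :
    toSections f V = (X.presheaf.map (homOfLE h).op).hom.comp (toSections f U) := by
  rw [toSections, toSections, ← CommRingCat.hom_comp, Category.assoc, Scheme.Hom.appLE_map]

/-- The sections of the sheaf `(⋀ⁿ Ω_{X/R})^{⊗ r}` over an affine open `U`. -/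
abbrev AffineForms (n r : ℕ) (U : X.affineOpens) : Type u :=
  @FormModule R Γ(X, U.1) _ _ (sectionsAlgebra f U.1) n r

/-- Restriction of `r`-canonical forms from an affine open `U` to an affine open `V ⊆ U`. -/
def AffineForms.res (n r : ℕ) {U V : X.affineOpens} (h : V.1 ≤ U.1) :
    AffineForms f n r U →+ AffineForms f n r V :=
  letI := sectionsAlgebra f U.1
  letI := sectionsAlgebra f V.1
  letI : Algebra Γ(X, U.1) Γ(X, V.1) := (X.presheaf.map (homOfLE h).op).hom.toAlgebra
  haveI : IsScalarTower R Γ(X, U.1) Γ(X, V.1) :=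
    IsScalarTower.of_algebraMap_eq' (toSections_res f h)
  (formMap R Γ(X, U.1) Γ(X, V.1) n r).toAddMonoidHom

/-- `H⁰(X, rK_X)` for `X` of relative dimension `n` over `Spec R`: the global sections of
`(⋀ⁿ Ω_{X/R})^{⊗ r}`, i.e. the families of sections over all affine opens that are compatible
with restriction. -/
def PluricanonicalForms (n r : ℕ) : AddSubgroup (∀ U : X.affineOpens, AffineForms f n r U) where
  carrier := {α | ∀ (U V : X.affineOpens) (h : V.1 ≤ U.1), AffineForms.res f n r h (α U) = α V}
  zero_mem' := fun _ _ _ => map_zero _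
  add_mem' := fun {a b} ha hb U V h => by
    rw [Pi.add_apply, Pi.add_apply, map_add, ha U V h, hb U V h]
  neg_mem' := fun {a} ha U V h => by
    rw [Pi.neg_apply, Pi.neg_apply, map_neg, ha U V h]

/-- The set `X(S)` of points of `X` with values in an `R`-algebra `S`: the morphisms
`Spec S ⟶ X` over `Spec R`. -/
@[ext]
structure Points (S : Type u) [CommRing S] [Algebra R S] where
  /-- the underlying morphism of schemes -/
  hom : Spec (.of S) ⟶ X
  w : hom ≫ f = Spec.map (CommRingCat.ofHom (algebraMap R S))

namespace Points

variable {f} {S : Type u} [CommRing S] [Algebra R S]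

/-- The map `X(R) → X(S)`; for `S = R ⧸ 𝔪ᵏ` it is the reduction modulo `𝔪ᵏ`. -/
def reduce (S : Type u) [CommRing S] [Algebra R S] (x : Points f R) : Points f S where
  hom := Spec.map (CommRingCat.ofHom (algebraMap R S)) ≫ x.hom
  w := by
    rw [Category.assoc, x.w, ← Spec.map_comp, ← CommRingCat.ofHom_comp]

/-- The point `x` factors through the open `U`, i.e. `x ∈ U(S)`. -/
def MemOpen (x : Points f S) (U : X.Opens) : Prop := (⊤ : (Spec (.of S)).Opens) ≤ x.hom ⁻¹ᵁ U

/-- The evaluation `g ↦ x^* g = g(x)` of functions on `U` at a point `x ∈ U(S)`. -/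
def eval (x : Points f S) {U : X.Opens} (h : x.MemOpen U) : Γ(X, U) →+* S :=
  (x.hom.appLE U ⊤ h ≫ (Scheme.ΓSpecIso (.of S)).hom).hom

/-- The analytic topology on `X(S)` for a topological ring `S`: the coarsest one for which the
sets `U(S)`, for `U ⊆ X` affine open, are open and regular functions on `U` are
continuous on `U(S)`. -/
instance [TopologicalSpace S] : TopologicalSpace (Points f S) :=
  TopologicalSpace.generateFrom
    {s | ∃ (U : X.affineOpens) (g : Γ(X, U.1)) (V : Set S), IsOpen V ∧
      s = {x : Points f S | ∃ h : x.MemOpen U.1, x.eval h g ∈ V}}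

instance [TopologicalSpace S] : MeasurableSpace (Points f S) := borel _

instance [TopologicalSpace S] : BorelSpace (Points f S) := ⟨rfl⟩

end Points

/-- The value of the form `α` at the point `x ∈ X(S)`, that is, its pullback in the fibre
`x^*((⋀ⁿ Ω_{X/R})^{⊗ r})`, is zero. (The fibre is `S ⊗ (⋀ⁿ Ω_{U/R})^{⊗ r}` for any affine open
`U` with `x ∈ U(S)`; such a `U` exists when `S` is local.) -/
def VanishesAt {f : X ⟶ Spec (.of R)} {n r : ℕ} (α : PluricanonicalForms f n r)
    {S : Type u} [CommRing S] [Algebra R S] (x : Points f S) : Prop :=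
  ∃ (U : X.affineOpens) (h : x.MemOpen U.1),
    letI : Algebra Γ(X, U.1) S := (x.eval h).toAlgebra
    (1 : S) ⊗ₜ[Γ(X, U.1)] (α.1 U) = 0

/-- A system of local (étale) coordinates `u₁, …, uₙ` on an affine open `U` of `X` over `R`:
regular functions whose differentials form a basis of `Ω_{U/R}`. -/
structure CoordinateChart (n : ℕ) where
  /-- the domain of the coordinates -/
  U : X.affineOpens
  /-- the coordinates -/
  u : Fin n → Γ(X, U.1)
  isBasis : letI := sectionsAlgebra f U.1
    ∃ b : Module.Basis (Fin n) Γ(X, U.1) Ω[Γ(X, U.1)⁄R],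
      ∀ i, b i = KaehlerDifferential.D R Γ(X, U.1) (u i)

/-- The generator `(du)^{⊗ r} = (du₁ ∧ ⋯ ∧ duₙ)^{⊗ r}` of the `r`-canonical forms on the domain
of a coordinate chart. -/
def CoordinateChart.duPow {f : X ⟶ Spec (.of R)} {n : ℕ} (c : CoordinateChart f n) (r : ℕ) :
    AffineForms f n r c.U :=
  letI := sectionsAlgebra f c.U.1
  (PiTensorProduct.tprod Γ(X, c.U.1) fun _ : Fin r =>
    exteriorPower.ιMulti Γ(X, c.U.1) n fun i => KaehlerDifferential.D R Γ(X, c.U.1) (c.u i) :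
    FormModule R Γ(X, c.U.1) n r)

/-- The scheme `X` over `Spec R` is projective: it is a closed subscheme of some
projective space `ℙᴺ_R = Proj R[x₀, …, x_N]` over `R`. -/
def IsProjective : Prop :=
  ∃ N : ℕ,
    letI := MvPolynomial.gradedAlgebra (σ := Fin (N + 1)) (R := R)
    ∃ i : X ⟶ Proj (MvPolynomial.homogeneousSubmodule (Fin (N + 1)) R),
      IsClosedImmersion i ∧
      i ≫ Proj.toSpecZero (MvPolynomial.homogeneousSubmodule (Fin (N + 1)) R) ≫
        Spec.map (CommRingCat.ofHom
          (algebraMap R (MvPolynomial.homogeneousSubmodule (Fin (N + 1)) R 0))) = f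

/-- The structure morphism of the special fibre of a scheme over a local ring. -/
abbrev specialFibre [IsLocalRing R] :
    Limits.pullback f (Spec.map (CommRingCat.ofHom (IsLocalRing.residue R))) ⟶
      Spec (.of (IsLocalRing.ResidueField R)) :=
  Limits.pullback.snd f (Spec.map (CommRingCat.ofHom (IsLocalRing.residue R)))

end Scheme

section LocalField

-- A finite extension of `ℚ_p` is the same as a non-archimedean local field of characteristic `0`.
variable (K : Type u) [Field K] [ValuativeRel K] [TopologicalSpace K]
  [IsNonarchimedeanLocalField K]

/-- The cardinality `q` of the residue field of `K`. -/
def residueCard : ℕ := Nat.card 𝓀[K]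

theorem residueCard_ne_zero : (residueCard K : ℝ≥0) ≠ 0 :=
  Nat.cast_ne_zero.mpr Nat.card_pos.ne'

variable {K} in
/-- The absolute value `|a| = q^{-v(a)}` on `K`, where `v` is the normalized valuation. -/
def normAbs (a : K) : ℝ :=
  (WithZeroMulInt.toNNReal (residueCard_ne_zero K)
    (IsNonarchimedeanLocalField.valueGroupWithZeroIsoInt K (ValuativeRel.valuation K a)) : ℝ≥0)

/-- The ring of integers as a compact set with non-empty interior. -/
def integersCompacts : TopologicalSpace.PositiveCompacts K where
  carrier := {x | ValuativeRel.valuation K x ≤ 1}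
  isCompact' := IsNonarchimedeanLocalField.isCompact_closedBall K 1
  interior_nonempty' := by
    refine ⟨0, mem_interior_iff_mem_nhds.mpr ?_⟩
    refine Filter.mem_of_superset
      ((IsValuativeTopology.hasBasis_nhds_zero' K).mem_of_mem (i := 1) one_ne_zero) ?_
    intro x hx
    exact le_of_lt (Set.mem_ofPred_eq ▸ hx : ValuativeRel.valuation K x < _)

/-- The Haar measure on `Kⁿ`, normalized such that `𝒪ⁿ` has measure `1`. -/
def haarPow [MeasurableSpace K] [BorelSpace K] (n : ℕ) : Measure (Fin n → K) :=
  Measure.pi fun _ => Measure.addHaarMeasure (integersCompacts K)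

variable {K} {X : Scheme.{u}} {f : X ⟶ Spec (.of 𝒪[K])}

/-- The coordinate map `u = (u₁, …, uₙ) : U(𝒪) → 𝒪ⁿ ⊆ Kⁿ` of a chart. -/
def CoordinateChart.coord {n : ℕ} (c : CoordinateChart f n) (x : Points f 𝒪[K])
    (h : x.MemOpen c.U.1) : Fin n → K :=
  fun i => (x.eval h (c.u i) : 𝒪[K])

/-- `μ` is the canonical measure on `X(𝒪)`: for every system of coordinates `u` on an affine open
`U` and every point `y ∈ U(𝔽_q)`, the coordinate map `u` takes `μ` on the fibre of the reduction
map `X(𝒪) → X(𝔽_q)` over `y` to the Haar measure on its image, a translate of `(π𝒪)ⁿ`. -/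
def IsCanonicalMeasure (f : X ⟶ Spec (.of 𝒪[K])) [MeasurableSpace K] [BorelSpace K] (n : ℕ)
    (μ : Measure (Points f 𝒪[K])) : Prop :=
  ∀ (c : CoordinateChart f n) (y : Points f 𝓀[K]), y.MemOpen c.U.1 →
    ∀ s : Set (Points f 𝒪[K]), MeasurableSet s → (∀ x ∈ s, x.reduce 𝓀[K] = y) →
      μ s = haarPow K n {v | ∃ x ∈ s, ∃ h : x.MemOpen c.U.1, c.coord x h = v}

/-- The canonical measure `μ_X` on `X(𝒪) = X(K)`, for `X` smooth and proper over `𝒪` of relative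
dimension `n`: the unique measure with the property `IsCanonicalMeasure`. -/
def canonicalMeasure (f : X ⟶ Spec (.of 𝒪[K])) [MeasurableSpace K] [BorelSpace K] (n : ℕ) :
    Measure (Points f 𝒪[K]) :=
  Classical.epsilon (IsCanonicalMeasure f n)

/-- `t` is the value at `x ∈ X(𝒪)` of the density `|α| / dμ_X^r`: for every system of coordinates
`u` around `x`, if `α = a(u) (du)^{⊗ r}`, then `t = |a(x)|`. -/
def IsDensityAt {n r : ℕ} (α : PluricanonicalForms f n r) (x : Points f 𝒪[K]) (t : ℝ) : Prop :=
  ∀ (c : CoordinateChart f n) (h : x.MemOpen c.U.1) (a : Γ(X, c.U.1)),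
    α.1 c.U = a • c.duPow r → t = normAbs ((x.eval h a : 𝒪[K]) : K)

/-- The density `|α| / dμ_X^r` of `|α|` with respect to the canonical measure: locally it is
`|a(u)|` if `α = a(u) (du)^{⊗ r}`. -/
def density {n r : ℕ} (α : PluricanonicalForms f n r) (x : Points f 𝒪[K]) : ℝ :=
  Classical.epsilon (IsDensityAt α x)

/-- The function `(|α| / dμ_X^r)^s`, so that `|α|^s dμ_X^{1 - rs}` is its product with `dμ_X`:
locally, this is `|a(u)|^s du` if `α = a(u) (du)^{⊗ r}`. -/
def densityPow {n r : ℕ} (α : PluricanonicalForms f n r) (s : ℂ) (x : Points f 𝒪[K]) : ℂ :=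
  (density α x : ℂ) ^ s

/-- The global Igusa zeta function `‖α‖_s = ∫_{X(K)} |α|^s dμ_X^{1 - rs}`. -/
def sNorm [MeasurableSpace K] [BorelSpace K] {n r : ℕ} (α : PluricanonicalForms f n r)
    (s : ℂ) : ℂ :=
  ∫ x, densityPow α s x ∂(canonicalMeasure f n)

/-- The number `N_k` of zeros of `α` modulo `𝔪ᵏ` on `X(𝒪 ⧸ 𝔪ᵏ)`. -/
def zeroCount {n r : ℕ} (α : PluricanonicalForms f n r) (k : ℕ) : ℕ :=
  Nat.card {x : Points f (𝒪[K] ⧸ 𝓂[K] ^ k) // VanishesAt α x}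

end LocalField

end PluriForm

end

/-! Let `V k` be the set of integral points at which `α` vanishes modulo `𝔪ᵏ⁺¹`. If `α = a (du)^{⊗
r}` near `x`, then `x ∈ V k` means `a(x) ∈ 𝔪ᵏ⁺¹`, so `|α|` takes the value `q⁻ᵐ` at `x`, where `m`
is the number of sets `V k` containing `x`. A residue class modulo `𝔪ᵏ` has canonical measure
`q^(-kn)`, hence `μ(V (k-1)) = N_k / q^(kn)`. With `w = q⁻ˢ`, integrate the identity `wᵐ = 1 - (1 -
w) ∑_{j<m} wʲ` term by term; this gives `μ(X) - (1 - w) ∑ wʲ μ(V j)`, which is the formula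
(`integral_pow_level`).

Two inputs remain. The first is Hensel's lemma. Coordinates make a chart formally étale over affine
space (`formallyEtale_of_basis`), so an integral point is determined by its residue point and its
coordinates, and coordinates with the right residues can be prescribed freely. Residue classes thus
become boxes, which yields their measures, the existence of the canonical measure and its
independence of the charts.

The second is the convergence of `∑ N_k / q^(kn)`, needed because `|w| = 1` is allowed when `Re s =
0`; it also shows that the points with `α(x) = 0` form a null set. As `X` is integral, the
coefficient `a` of `α ≠ 0` is nonzero on every nonempty chart. It is algebraic over the ring
generated by the coordinates, so it divides a nonzero polynomial in them
(`exists_dvd_aeval_coordinates`). Zeros of `α` modulo `𝔪ᵏ` therefore inject into the zeros modulo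
`𝔪ᵏ` of finitely many nonzero polynomials, whose proportion decays exponentially in `k`
(`exists_card_zeros_le`). -/

namespace PluriForm

/-! ### Étale coordinates and Hensel's lemma -/

section Coordinates

variable {R A σ : Type*} [CommRing R] [CommRing A] [Algebra R A]

/-- A formally smooth algebra is formally étale over the polynomial ring of a system of
coordinates. -/
theorem formallyEtale_of_basis [Algebra (MvPolynomial σ R) A]
    [IsScalarTower R (MvPolynomial σ R) A] [Algebra.FormallySmooth R A]
    (b : Module.Basis σ A Ω[A⁄R])
    (hb : ∀ i, b i = KaehlerDifferential.D R A (algebraMap (MvPolynomial σ R) A (.X i))) :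
    Algebra.FormallyEtale (MvPolynomial σ R) A := by
  let b' := (KaehlerDifferential.mvPolynomialBasis R σ).baseChange A
  have hmap : KaehlerDifferential.mapBaseChange R (MvPolynomial σ R) A =
      (b'.equiv b (Equiv.refl σ)).toLinearMap := by
    refine b'.ext fun i => ?_
    rw [LinearEquiv.coe_coe, b'.equiv_apply]
    simp [b', hb]
  have hbij : Function.Bijective (KaehlerDifferential.mapBaseChange R (MvPolynomial σ R) A) := by
    rw [hmap]; exact LinearEquiv.bijective _
  have h1 : Subsingleton (Algebra.H1Cotangent R A) := inferInstance
  -- In the Jacobi–Zariski sequence of `R → R[X] → A`, surjectivity of `mapBaseChange` kills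
  -- `Ω[A⁄R[X]]`, while its injectivity and the vanishing of `H1Cotangent R A` (formal smoothness)
  -- kill `H1Cotangent R[X] A`.
  refine ⟨?_, ?_⟩
  · refine subsingleton_of_forall_eq 0 fun x => ?_
    obtain ⟨y, rfl⟩ := KaehlerDifferential.map_surjective R (MvPolynomial σ R) A x
    obtain ⟨z, rfl⟩ := hbij.2 y
    exact (KaehlerDifferential.exact_mapBaseChange_map R (MvPolynomial σ R) A _).mpr ⟨z, rfl⟩
  · refine subsingleton_of_forall_eq 0 fun x => ?_
    have hx : Algebra.H1Cotangent.δ R (MvPolynomial σ R) A x = 0 := by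
      apply hbij.1
      rw [map_zero]
      exact (Algebra.H1Cotangent.exact_δ_mapBaseChange R (MvPolynomial σ R) A _).mpr ⟨x, rfl⟩
    obtain ⟨y, rfl⟩ := (Algebra.H1Cotangent.exact_map_δ R (MvPolynomial σ R) A x).mp hx
    rw [Subsingleton.elim y 0, map_zero]

/-- Points over an ideal with zero intersection of powers are determined by their coordinates. -/
theorem algHom_ext_of_coordinates [Algebra.FormallySmooth R A] {u : σ → A}
    (b : Module.Basis σ A Ω[A⁄R]) (hb : ∀ i, b i = KaehlerDifferential.D R A (u i))
    {B : Type*} [CommRing B] [Algebra R B] (I : Ideal B) (hI : ⨅ k : ℕ, I ^ k = ⊥)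
    (g₁ g₂ : A →ₐ[R] B)
    (h : ∀ a, Ideal.Quotient.mk I (g₁ a) = Ideal.Quotient.mk I (g₂ a))
    (hu : ∀ i, g₁ (u i) = g₂ (u i)) : g₁ = g₂ := by
  algebraize [(MvPolynomial.aeval u : MvPolynomial σ R →ₐ[R] A).toRingHom]
  have : IsScalarTower R (MvPolynomial σ R) A := .of_algebraMap_eq fun r => by
    simp [RingHom.algebraMap_toAlgebra]
  have := formallyEtale_of_basis (R := R) b fun i => by
    simp [hb, RingHom.algebraMap_toAlgebra]
  -- Through `g₁`, `B` becomes an algebra over the polynomial ring. Agreement on the coordinates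
  -- makes `g₂` linear over it too, and unramifiedness gives uniqueness.
  let : Algebra (MvPolynomial σ R) B :=
    (g₁.comp (MvPolynomial.aeval u : MvPolynomial σ R →ₐ[R] A)).toRingHom.toAlgebra
  let f₁ : A →ₐ[MvPolynomial σ R] B := { g₁ with commutes' := fun p => rfl }
  let f₂ : A →ₐ[MvPolynomial σ R] B :=
    { g₂ with
      commutes' := fun p => by
        change (g₂.comp (MvPolynomial.aeval u : MvPolynomial σ R →ₐ[R] A)) p =
          (g₁.comp (MvPolynomial.aeval u : MvPolynomial σ R →ₐ[R] A)) p
        congr 1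
        ext i
        simp [hu] }
  have := Algebra.FormallyUnramified.ext_of_iInf (R := MvPolynomial σ R) (I := I) (g₁ := f₁) (g₂ := f₂) hI h
  ext a
  exact DFunLike.congr_fun this a

/-- Hensel's lemma for points of a smooth algebra with given coordinates. -/
theorem exists_algHom_of_coordinates [Algebra.FormallySmooth R A] {u : σ → A}
    (b : Module.Basis σ A Ω[A⁄R]) (hb : ∀ i, b i = KaehlerDifferential.D R A (u i))
    {B : Type*} [CommRing B] [Algebra R B] (I : Ideal B) [IsAdicComplete I B]
    (g : A →ₐ[R] B ⧸ I) (v : σ → B) (hv : ∀ i, Ideal.Quotient.mk I (v i) = g (u i)) :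
    ∃ G : A →ₐ[R] B, (∀ a, Ideal.Quotient.mk I (G a) = g a) ∧ ∀ i, G (u i) = v i := by
  algebraize [(MvPolynomial.aeval u : MvPolynomial σ R →ₐ[R] A).toRingHom]
  have : IsScalarTower R (MvPolynomial σ R) A := .of_algebraMap_eq fun r => by
    simp [RingHom.algebraMap_toAlgebra]
  have := formallyEtale_of_basis (R := R) b fun i => by
    simp [hb, RingHom.algebraMap_toAlgebra]
  -- With `Xᵢ` acting on `B` as `v i`, any lift of `g` that is linear over the polynomial ring has
  -- coordinates `v`.
  let : Algebra (MvPolynomial σ R) B :=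
    (MvPolynomial.aeval v : MvPolynomial σ R →ₐ[R] B).toRingHom.toAlgebra
  have : IsScalarTower R (MvPolynomial σ R) B := .of_algebraMap_eq fun r => by
    simp [RingHom.algebraMap_toAlgebra]
  let f : A →ₐ[MvPolynomial σ R] B ⧸ I :=
    { g with
      commutes' := fun p => by
        change (g.comp (MvPolynomial.aeval u : MvPolynomial σ R →ₐ[R] A)) p =
          ((Ideal.Quotient.mkₐ R I).comp (MvPolynomial.aeval v : MvPolynomial σ R →ₐ[R] B)) p
        congr 1
        ext i
        simp [hv] }
  obtain ⟨G, hG⟩ := Algebra.FormallySmooth.exists_mkₐ_comp_eq_of_isAdicComplete f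
  refine ⟨G.restrictScalars R, fun a => DFunLike.congr_fun hG a, fun i => ?_⟩
  have := G.commutes (.X i)
  simpa [RingHom.algebraMap_toAlgebra] using this

end Coordinates

/-! ### Functions on a chart are algebraic over the coordinates -/

section Algebraic

variable {R A : Type u} {σ : Type*} [CommRing R] [CommRing A] [Algebra R A]

/-- A function on a smooth integral algebra divides a nonzero polynomial in the coordinates. -/
theorem exists_dvd_aeval_coordinates [IsDomain A] [Algebra.FormallySmooth R A]
    [Algebra.FiniteType R A] {u : σ → A} (b : Module.Basis σ A Ω[A⁄R])
    (hb : ∀ i, b i = KaehlerDifferential.D R A (u i)) {a : A} (ha : a ≠ 0) :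
    ∃ Q : MvPolynomial σ R, MvPolynomial.aeval u Q ≠ 0 ∧ a ∣ MvPolynomial.aeval u Q := by
  algebraize [(MvPolynomial.aeval u : MvPolynomial σ R →ₐ[R] A).toRingHom]
  have : IsScalarTower R (MvPolynomial σ R) A := .of_algebraMap_eq fun r => by
    simp [RingHom.algebraMap_toAlgebra]
  have := formallyEtale_of_basis (R := R) b fun i => by
    simp [hb, RingHom.algebraMap_toAlgebra]
  -- Taking the image `R[u] ⊆ A` as base avoids proving the coordinates algebraically independent.
  -- The extension `Frac A / Frac R[u]` is formally unramified and essentially of finite type, hence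
  -- separable algebraic.
  let B := (MvPolynomial.aeval u : MvPolynomial σ R →ₐ[R] A).range
  let : Algebra (MvPolynomial σ R) B :=
    (MvPolynomial.aeval u : MvPolynomial σ R →ₐ[R] A).rangeRestrict.toRingHom.toAlgebra
  have : IsScalarTower (MvPolynomial σ R) B A := .of_algebraMap_eq fun _ => rfl
  have : Algebra.FormallyUnramified B A := .of_restrictScalars (MvPolynomial σ R) B A
  have : Algebra.EssFiniteType B A := .of_comp R B A
  let F := FractionRing B
  let L := FractionRing A
  let : Algebra F L := FractionRing.liftAlgebra B L
  have : Algebra.FormallyUnramified A L := .of_isLocalization (nonZeroDivisors A)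
  have : Algebra.FormallyUnramified B L := .comp B A L
  have : Algebra.FormallyUnramified F L := .of_restrictScalars B F L
  have : Algebra.EssFiniteType A L := .of_isLocalization L (nonZeroDivisors A)
  have : Algebra.EssFiniteType B L := .comp B A L
  have : Algebra.EssFiniteType F L := .of_comp B F L
  have := (Algebra.FormallyUnramified.isSeparable F L).isAlgebraic
  have hL : IsAlgebraic B (algebraMap A L a) :=
    (IsFractionRing.isAlgebraic_iff B F L).mpr (Algebra.IsAlgebraic.isAlgebraic _)
  have hA : IsAlgebraic B a :=
    (isAlgebraic_algebraMap_iff (IsFractionRing.injective A L)).mp hL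
  -- A nonzero algebraic element of a domain divides a nonzero element of the base, namely the
  -- constant term of a suitable relation.
  obtain ⟨⟨_, Q, rfl⟩, hr, hd⟩ := hA.exists_nonzero_dvd (mem_nonZeroDivisors_of_ne_zero ha)
  refine ⟨Q, fun h => hr (Subtype.ext h), hd⟩

end Algebraic

/-! ### Coordinates make the module of forms free of rank one -/

section Forms

variable {R A : Type u} [CommRing R] [CommRing A] [Algebra R A] {n : ℕ} (r : ℕ)

/-- The basis of the module of `r`-canonical forms given by a basis of the differentials. -/
noncomputable def formBasis (b : Module.Basis (Fin n) A Ω[A⁄R]) :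
    Module.Basis (Fin r → Set.powersetCard (Fin n) n) A (FormModule R A n r) :=
  Basis.piTensorProduct fun _ => b.exteriorPower n

/-- The index type of `formBasis` is therefore a single point, which is why forms have rank one. -/
instance : Unique (Set.powersetCard (Fin n) n) where
  default := ⟨Finset.univ, by simp [Set.powersetCard]⟩
  uniq s := Subtype.ext ((Finset.card_eq_iff_eq_univ _).mp (s.2.trans (Fintype.card_fin n).symm))

theorem formBasis_default (b : Module.Basis (Fin n) A Ω[A⁄R]) :
    formBasis r b default =
      PiTensorProduct.tprod A fun _ => exteriorPower.ιMulti A n fun i => b i := by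
  rw [formBasis, Basis.piTensorProduct_apply]
  congr 1
  funext j
  rw [exteriorPower.basis_apply, exteriorPower.ιMulti_family]
  have : Subsingleton (Fin n ↪o Fin n) := Set.powersetCard.ofFinEmbEquiv.subsingleton
  rw [Subsingleton.elim (Set.powersetCard.ofFinEmbEquiv.symm _) (RelEmbedding.refl _)]
  rfl

variable {r}

theorem exists_eq_smul_tprod (b : Module.Basis (Fin n) A Ω[A⁄R]) (ω : FormModule R A n r) :
    ∃ a : A, ω = a • PiTensorProduct.tprod A fun _ => exteriorPower.ιMulti A n fun i => b i := by
  refine ⟨(formBasis r b).repr ω default, ?_⟩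
  rw [← formBasis_default]
  conv_lhs => rw [← (formBasis r b).sum_repr ω]
  rw [Fintype.sum_unique]

theorem smul_tprod_eq_zero (b : Module.Basis (Fin n) A Ω[A⁄R]) {a : A}
    (h : (a • PiTensorProduct.tprod A fun _ => exteriorPower.ιMulti A n fun i => b i :
      FormModule R A n r) = 0) : a = 0 := by
  rw [← formBasis_default] at h
  simpa using congrArg (fun x => (formBasis r b).repr x default) h

end Forms

/-! ### Forms that vanish on a basic open set -/

section Saturation

variable {A M : Type*} [CommRing A] [AddCommGroup M] [Module A M]

/-- The elements of a module that a power of `t` multiplies into a given submodule. -/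
def powSaturation (t : A) (T : Submodule A M) : Submodule A M where
  carrier := {x | ∃ N : ℕ, t ^ N • x ∈ T}
  zero_mem' := ⟨0, by simp⟩
  add_mem' := by
    rintro x y ⟨N, hx⟩ ⟨N', hy⟩
    refine ⟨N + N', ?_⟩
    rw [smul_add, pow_add]
    exact T.add_mem (mul_comm (t ^ N) _ ▸ (mul_smul (t ^ N') (t ^ N) x).symm ▸ T.smul_mem _ hx)
      ((mul_smul (t ^ N) (t ^ N') y).symm ▸ T.smul_mem _ hy)
  smul_mem' := by
    rintro c x ⟨N, hx⟩
    exact ⟨N, smul_comm c (t ^ N) x ▸ T.smul_mem c hx⟩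

theorem mem_powSaturation {t : A} {T : Submodule A M} {x : M} :
    x ∈ powSaturation t T ↔ ∃ N : ℕ, t ^ N • x ∈ T := Iff.rfl

end Saturation

section LocalizationForms

variable {R A B : Type u} [CommRing R] [CommRing A] [CommRing B]
  [Algebra R A] [Algebra R B] [Algebra A B] [IsScalarTower R A B] {n r : ℕ} {t : A}

/-- Denominators are cleared twice: first in the coefficients of `ω` over `B`, then in the resulting
equality, which holds only after localization. -/
theorem mem_powSaturation_span_of_basis [IsLocalization.Away t B]
    (b : Module.Basis (Fin n) B Ω[B⁄R]) {w : Fin n → Ω[A⁄R]}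
    (hw : ∀ i, b i = KaehlerDifferential.map R R A B (w i)) (ω : Ω[A⁄R]) :
    ω ∈ powSaturation t (Submodule.span A (Set.range w)) := by
  obtain ⟨⟨_, N, rfl⟩, hc⟩ := IsLocalization.exist_integer_multiples_of_finite
    (Submonoid.powers t) fun i => b.repr (KaehlerDifferential.map R R A B ω) i
  choose c hc using hc
  have h : KaehlerDifferential.map R R A B (t ^ N • ω) =
      KaehlerDifferential.map R R A B (∑ i, c i • w i) := by
    rw [map_smul, map_sum, ← b.sum_repr (KaehlerDifferential.map R R A B ω), Finset.smul_sum]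
    refine Finset.sum_congr rfl fun i _ => ?_
    rw [map_smul, ← hw, ← smul_assoc, ← algebraMap_smul B (c i), hc]
  obtain ⟨⟨_, N', rfl⟩, h'⟩ := IsLocalizedModule.exists_of_eq (S := Submonoid.powers t) h
  refine ⟨N' + N, ?_⟩
  rw [pow_add, mul_smul]
  rw [Submonoid.smul_def, Submonoid.smul_def] at h'
  erw [h']
  exact Submodule.smul_mem _ _ (Submodule.sum_mem _ fun i _ =>
    Submodule.smul_mem _ _ (Submodule.subset_span ⟨i, rfl⟩))

/-- Multilinearity collects the powers of `t` into one factor. What remains is a wedge of linear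
combinations of the `n` vectors `w i`, which is a multiple of their own wedge. -/
theorem ιMulti_mem_powSaturation {M : Type*} [AddCommGroup M] [Module A M] {w : Fin n → M}
    (hw : ∀ ω, ω ∈ powSaturation t (Submodule.span A (Set.range w))) (x : ⋀[A]^n M) :
    x ∈ powSaturation t (Submodule.span A {exteriorPower.ιMulti A n w}) := by
  have hx : x ∈ Submodule.span A (Set.range (exteriorPower.ιMulti A n (M := M))) := by
    rw [exteriorPower.ιMulti_span]; trivial
  refine Submodule.span_le.mpr ?_ hx
  rintro _ ⟨v, rfl⟩
  choose N hN using fun j => mem_powSaturation.mp (hw (v j))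
  refine ⟨∑ j, N j, ?_⟩
  rw [← Finset.prod_pow_eq_pow_sum, ← AlternatingMap.map_smul_univ]
  choose c hc using fun j => (Submodule.mem_span_range_iff_exists_fun A).mp (hN j)
  let T := Submodule.span A {exteriorPower.ιMulti A n w}
  -- Modulo `T`, the alternating map on `Aⁿ` need only be tested on injective tuples of basis
  -- vectors; these are permutations and give `± ιMulti w`.
  have h0 : T.mkQ.compAlternatingMap ((exteriorPower.ιMulti A n (M := M)).compLinearMap
      (Fintype.linearCombination A w)) = 0 := by
    refine Module.Basis.ext_alternating (Pi.basisFun A (Fin n)) fun v hv => ?_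
    have hσ : (fun i => Fintype.linearCombination A w (Pi.basisFun A (Fin n) (v i))) =
        w ∘ Equiv.ofBijective v (Finite.injective_iff_bijective.mp hv) := by
      funext i
      simp [Fintype.linearCombination_apply_single]
    simp only [LinearMap.compAlternatingMap_apply, AlternatingMap.compLinearMap_apply,
      AlternatingMap.zero_apply, Submodule.mkQ_apply, Submodule.Quotient.mk_eq_zero]
    erw [hσ]
    rw [AlternatingMap.map_perm]
    exact T.smul_mem _ (Submodule.mem_span_singleton_self _)
  have h1 := DFunLike.congr_fun h0 c
  simp only [LinearMap.compAlternatingMap_apply, AlternatingMap.compLinearMap_apply,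
    AlternatingMap.zero_apply, Submodule.mkQ_apply, Submodule.Quotient.mk_eq_zero] at h1
  convert h1 using 3 with j
  rw [← hc]
  rfl

theorem tprod_mem_powSaturation {M : Type*} [AddCommGroup M] [Module A M] {y : M}
    (hy : ∀ x, x ∈ powSaturation t (Submodule.span A {y})) (m : ⨂[A]^r M) :
    m ∈ powSaturation t
      (Submodule.span A {(PiTensorProduct.tprod A fun _ : Fin r => y : ⨂[A]^r M)}) := by
  induction m using PiTensorProduct.induction_on with
  | add x y hx hy => exact Submodule.add_mem _ hx hy
  | smul_tprod c v =>
    refine Submodule.smul_mem _ _ ?_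
    choose N hN using fun j => mem_powSaturation.mp (hy (v j))
    choose c hc using fun j => Submodule.mem_span_singleton.mp (hN j)
    refine ⟨∑ j, N j, ?_⟩
    rw [← Finset.prod_pow_eq_pow_sum, ← MultilinearMap.map_smul_univ]
    simp_rw [← hc, MultilinearMap.map_smul_univ]
    exact Submodule.smul_mem _ _ (Submodule.mem_span_singleton_self _)

/-- A form that vanishes on a basic open set with coordinates is killed by a power of the
function defining the set. -/
theorem exists_pow_smul_eq_zero_of_formMap_eq_zero [IsDomain A] [IsLocalization.Away t B]
    (ht : t ≠ 0) (b : Module.Basis (Fin n) B Ω[B⁄R]) {m : FormModule R A n r}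
    (hm : formMap R A B n r m = 0) : ∃ N : ℕ, t ^ N • m = 0 := by
  choose p hp using fun i => IsLocalizedModule.surj (Submonoid.powers t)
    (KaehlerDifferential.map R R A B) (b i)
  -- Scaling by powers of `t`, which are units in `B`, makes the basis come from differentials over
  -- `A`.
  let b' : Module.Basis (Fin n) B Ω[B⁄R] :=
    b.unitsSMul fun i => (IsLocalization.map_units B (p i).2).unit
  have hb' : ∀ i, b' i = KaehlerDifferential.map R R A B (p i).1 := fun i => by
    rw [← hp, Module.Basis.unitsSMul_apply, Submonoid.smul_def]
    exact algebraMap_smul B _ _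
  obtain ⟨N, hN⟩ := tprod_mem_powSaturation
    (ιMulti_mem_powSaturation (t := t) (mem_powSaturation_span_of_basis b' hb')) m
  obtain ⟨c, hc⟩ := Submodule.mem_span_singleton.mp hN
  refine ⟨N, ?_⟩
  have h := congrArg (formMap R A B n r) hc
  rw [map_smul, map_smul, hm, smul_zero, formMap_tprod_ιMulti, ← algebraMap_smul B] at h
  simp_rw [← hb'] at h
  have h0 := smul_tprod_eq_zero b' h
  rw [← hc, (map_eq_zero_iff _ (IsLocalization.injective B
    (powers_le_nonZeroDivisors_of_noZeroDivisors ht))).mp h0, zero_smul]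

end LocalizationForms

/-! ### Counting zeros of polynomials modulo powers of `𝔪` -/

section Counting

/-- All fibres of `φ` are translates of the kernel, so taking preimages preserves proportions. -/
theorem card_preimage_mul_card {G H : Type*} [AddCommGroup G] [AddCommGroup H] [Finite G]
    (φ : G →+ H) (hφ : Function.Surjective φ) (S : Set H) :
    Nat.card (φ ⁻¹' S) * Nat.card H = Nat.card S * Nat.card G := by
  have : Finite H := Finite.of_surjective φ hφ
  have e : φ ⁻¹' S ≃ S × φ.ker :=
    { toFun := fun x => (⟨φ x, x.2⟩, ⟨x - Function.surjInv hφ (φ x), by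
        rw [AddMonoidHom.mem_ker, map_sub, Function.surjInv_eq hφ, sub_self]⟩)
      invFun := fun y => ⟨y.2 + Function.surjInv hφ y.1, by
        have : φ (y.2 : G) = 0 := y.2.2
        simp [Function.surjInv_eq, this]⟩
      left_inv := fun x => by simp
      right_inv := fun y => by
        have : φ (y.2 : G) = 0 := y.2.2
        ext <;> simp [Function.surjInv_eq, this] }
  rw [Nat.card_congr e, Nat.card_prod, mul_assoc,
    AddSubgroup.card_eq_card_quotient_mul_card_addSubgroup φ.ker,
    Nat.card_congr (QuotientAddGroup.quotientKerEquivOfSurjective φ hφ).toEquiv,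
    mul_comm (Nat.card φ.ker)]

theorem pow_sub_dvd_of_pow_dvd_mul {O : Type*} [CommRing O] [IsDomain O] {p a b : O} {i k : ℕ}
    (hp : Prime p) (ha : ¬ p ^ i ∣ a) (h : p ^ k ∣ a * b) : p ^ (k - i) ∣ b := by
  rw [pow_dvd_iff_le_emultiplicity] at *
  rw [emultiplicity_mul hp] at h
  rw [not_le] at ha
  have : (k : ℕ∞) ≤ i + emultiplicity p b := h.trans (by gcongr)
  simpa [add_comm] using this

/-- A polynomial of degree `d` has at most `d` approximate zeros at pairwise distance. -/
theorem card_le_of_pow_dvd_eval {O : Type*} [CommRing O] [IsDomain O] {p : O} (hp : Prime p)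
    {i j d : ℕ} : ∀ {k : ℕ} {P : Polynomial O} {T : Finset O}, P.natDegree ≤ d →
      ¬ p ^ j ∣ P.coeff d → d * i + j ≤ k →
      (∀ s ∈ T, ∀ t ∈ T, s ≠ t → ¬ p ^ i ∣ s - t) → (∀ t ∈ T, p ^ k ∣ P.eval t) → T.card ≤ d := by
  classical
  induction d with
  | zero =>
    intro k P T hd hc hk _ hT
    by_contra! h
    obtain ⟨t, ht⟩ := Finset.card_pos.mp h
    refine hc ((pow_dvd_pow p (by lia)).trans (b := p ^ k) ?_)
    have := hT t ht
    rw [Polynomial.eq_C_of_natDegree_le_zero hd] at this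
    simpa using this
  | succ d ih =>
    intro k P T hd hc hk hT hP
    obtain rfl | ⟨t₀, ht₀⟩ := T.eq_empty_or_nonempty
    · simp
    -- Divide by `X - t₀` for one approximate zero `t₀`. At any other `t` of the set, `pᵏ` divides
    -- `(t - t₀) P₁(t)` while `pⁱ` does not divide `t - t₀`, so `p^(k-i)` divides `P₁(t)`. The
    -- coefficient that is assumed not divisible by `pʲ` is unchanged.
    let P₁ := P /ₘ (Polynomial.X - Polynomial.C t₀)
    have hP₁ : P = Polynomial.C (P.eval t₀) + (Polynomial.X - Polynomial.C t₀) * P₁ := by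
      conv_lhs => rw [← Polynomial.modByMonic_add_div P (Polynomial.X - Polynomial.C t₀),
        Polynomial.modByMonic_X_sub_C_eq_C_eval]
    have hdeg : P₁.natDegree ≤ d := by
      rw [Polynomial.natDegree_divByMonic _ (Polynomial.monic_X_sub_C t₀),
        Polynomial.natDegree_X_sub_C]
      lia
    have hcoeff : P.coeff (d + 1) = P₁.coeff d := by
      rw [hP₁, Polynomial.coeff_add, Polynomial.coeff_C_succ, sub_mul, Polynomial.coeff_sub,
        Polynomial.coeff_X_mul, Polynomial.coeff_C_mul,
        Polynomial.coeff_eq_zero_of_natDegree_lt (p := P₁) (n := d + 1) (by lia)]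
      simp
    have := ih (k := k - i) (P := P₁) (T := T.erase t₀) hdeg (hcoeff ▸ hc)
      (by rw [add_mul] at hk; lia)
      (fun s hs t ht => hT s (Finset.mem_of_mem_erase hs) t (Finset.mem_of_mem_erase ht))
      (fun t ht => by
        refine pow_sub_dvd_of_pow_dvd_mul hp
          (hT t (Finset.mem_of_mem_erase ht) t₀ ht₀ (Finset.ne_of_mem_erase ht)) ?_
        have h1 := dvd_sub (hP t (Finset.mem_of_mem_erase ht)) (hP t₀ ht₀)
        have h2 := congrArg (Polynomial.eval t) hP₁
        simp only [Polynomial.eval_add, Polynomial.eval_C, Polynomial.eval_mul,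
          Polynomial.eval_sub, Polynomial.eval_X] at h2
        rwa [h2, add_sub_cancel_left] at h1)
    rw [Finset.card_erase_of_mem ht₀] at this
    lia

open IsLocalRing

variable {O : Type*} [CommRing O] [IsDomain O] [IsDiscreteValuationRing O]

theorem card_quotient_maximalIdeal_pow (k : ℕ) :
    Nat.card (O ⧸ maximalIdeal O ^ k) = Nat.card (ResidueField O) ^ k := by
  have := cardQuot_pow_of_prime (P := maximalIdeal O) (i := k)
    (IsDiscreteValuationRing.not_a_field O)
  rwa [Submodule.cardQuot_apply, Submodule.cardQuot_apply] at this

variable [Finite (ResidueField O)]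

instance finite_quotient_maximalIdeal_pow (k : ℕ) : Finite (O ⧸ maximalIdeal O ^ k) :=
  Nat.finite_of_card_ne_zero
    (card_quotient_maximalIdeal_pow (O := O) k ▸ pow_ne_zero _ Nat.card_pos.ne')

/-- The number of zeros modulo `𝔪ᵏ` of a polynomial of degree `d` in one variable. -/
theorem card_zeros_mul_le {P : Polynomial O} {i j d k : ℕ} (hd : P.natDegree ≤ d)
    (hc : P.coeff d ∉ maximalIdeal O ^ j) (hk : d * i + j ≤ k) (hik : i ≤ k) :
    Nat.card {t : O ⧸ maximalIdeal O ^ k // Polynomial.aeval t P = 0} *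
      Nat.card (ResidueField O) ^ i ≤ d * Nat.card (ResidueField O) ^ k := by
  classical
  obtain ⟨p, hp⟩ := IsDiscreteValuationRing.exists_irreducible O
  have hmem : ∀ (k : ℕ) (x : O), x ∈ maximalIdeal O ^ k ↔ p ^ k ∣ x := fun k x => by
    rw [hp.maximalIdeal_eq, Ideal.span_singleton_pow, Ideal.mem_span_singleton]
  have hle := Ideal.pow_le_pow_right (I := maximalIdeal O) hik
  let φ : (O ⧸ maximalIdeal O ^ k) →+ (O ⧸ maximalIdeal O ^ i) :=
    (Ideal.Quotient.factor hle).toAddMonoidHom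
  have hφ : Function.Surjective φ := Ideal.Quotient.factor_surjective hle
  -- Lifts of distinct classes in `S` are incongruent modulo `𝔪ⁱ`, so `S` has at most `d` elements.
  -- The zeros lie in the preimage of `S`, whose fibres have `q^(k-i)` elements.
  let S : Set (O ⧸ maximalIdeal O ^ i) := φ '' {t | Polynomial.aeval t P = 0}
  have hS : Nat.card S ≤ d := by
    have hfin : S.Finite := Set.toFinite _
    have hlift : ∀ s : S, ∃ t : O, Ideal.Quotient.mk _ t = s.1 ∧ p ^ k ∣ P.eval t := by
      rintro ⟨_, t, ht, rfl⟩
      obtain ⟨t, rfl⟩ := Ideal.Quotient.mk_surjective t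
      refine ⟨t, rfl, ?_⟩
      rw [← hmem, ← Ideal.Quotient.eq_zero_iff_mem, ← ht]
      exact (Polynomial.aeval_algebraMap_apply _ t P).symm
    choose t ht htd using hlift
    have : Fintype S := Fintype.ofFinite _
    have hinj : Function.Injective t := fun s s' h => Subtype.ext (by rw [← ht, ← ht, h])
    rw [Nat.card_eq_fintype_card, ← Finset.card_univ, ← Finset.card_image_of_injective _ hinj]
    refine card_le_of_pow_dvd_eval hp.prime hd ((hmem _ _).not.mp hc) hk ?_ ?_
    · intro x hx y hy hxy h
      obtain ⟨s, -, rfl⟩ := Finset.mem_image.mp hx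
      obtain ⟨s', -, rfl⟩ := Finset.mem_image.mp hy
      rw [← hmem, ← Ideal.Quotient.eq, ht, ht] at h
      exact hxy (congrArg t (Subtype.ext h))
    · intro x hx
      obtain ⟨s, -, rfl⟩ := Finset.mem_image.mp hx
      exact htd s
  have hle : Nat.card {t : O ⧸ maximalIdeal O ^ k // Polynomial.aeval t P = 0} ≤
      Nat.card (φ ⁻¹' S) :=
    Nat.card_mono (Set.toFinite _) (Set.subset_preimage_image φ {t | Polynomial.aeval t P = 0})
  have h := card_preimage_mul_card φ hφ S
  rw [card_quotient_maximalIdeal_pow, card_quotient_maximalIdeal_pow] at h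
  calc _ ≤ _ := Nat.mul_le_mul_right _ hle
    _ = _ := h
    _ ≤ _ := Nat.mul_le_mul_right _ hS

/-- Sum over `β`: a fibre over the exceptional set `B` is bounded by all of `α`, any other by `c`.
-/
theorem sum_card_le {α β : Type*} [Finite α] [Finite β] (S : Set (α × β)) (B : Set β) {a c : ℝ}
    (hc : 0 ≤ c) (ha : Nat.card α ≤ a) (h : ∀ y ∉ B, (Nat.card {x // (x, y) ∈ S} : ℝ) ≤ c) :
    (Nat.card S : ℝ) ≤ a * Nat.card B + Nat.card β * c := by
  classical
  have := Fintype.ofFinite β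
  have := Fintype.ofFinite B
  let e : S ≃ Σ y : β, {x // (x, y) ∈ S} :=
    { toFun := fun z => ⟨z.1.2, z.1.1, z.2⟩
      invFun := fun z => ⟨(z.2.1, z.1), z.2.2⟩
      left_inv := fun _ => rfl
      right_inv := fun _ => rfl }
  rw [Nat.card_congr e, Nat.card_sigma, Nat.cast_sum]
  calc ∑ y, (Nat.card {x // (x, y) ∈ S} : ℝ) ≤ ∑ y, ((if y ∈ B then a else 0) + c) := by
        refine Finset.sum_le_sum fun y _ => ?_
        split_ifs with hy
        · exact (Nat.cast_le.mpr (Finite.card_subtype_le _)).trans (ha.trans (by linarith))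
        · simpa using h y hy
    _ = _ := by
        rw [Finset.sum_add_distrib, Finset.sum_const, Finset.sum_ite, Finset.sum_const_zero,
          Finset.sum_const, Nat.card_eq_fintype_card, Nat.card_eq_fintype_card,
          Finset.card_univ, Fintype.card_subtype]
        simp [mul_comm]

/-- The proportion of zeros modulo `𝔪ᵏ` of a nonzero polynomial decays exponentially in `k`. -/
theorem exists_card_zeros_le (n : ℕ) : ∀ {Q : MvPolynomial (Fin n) O}, Q ≠ 0 →
    ∃ (C : ℝ) (D : ℕ), 0 ≤ C ∧ 0 < D ∧ ∀ k : ℕ,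
      (Nat.card {v : Fin n → O ⧸ maximalIdeal O ^ k // MvPolynomial.aeval v Q = 0} : ℝ) ≤
        C * (Nat.card (ResidueField O) : ℝ) ^ (k * n) *
          ((Nat.card (ResidueField O) : ℝ)⁻¹) ^ (k / D) := by
  have hq1 : (1 : ℝ) < Nat.card (ResidueField O) := by exact_mod_cast Finite.one_lt_card
  set q : ℝ := ((Nat.card (ResidueField O) : ℕ) : ℝ) with hq
  have hq0 : 0 < q := by linarith
  have hqi : q⁻¹ ≤ 1 := inv_le_one_of_one_le₀ hq1.le
  induction n with
  | zero =>
    intro Q hQ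
    obtain ⟨c, rfl⟩ := MvPolynomial.C_surjective (Fin 0) Q
    have hc : c ≠ 0 := fun h => hQ (by simp [h])
    obtain ⟨k₀, hk₀⟩ : ∃ k₀, c ∉ maximalIdeal O ^ k₀ := by
      by_contra! h
      exact hc (by simpa [Ideal.iInf_pow_eq_bot_of_isLocalRing (maximalIdeal O) Ideal.IsPrime.ne_top'] using (Submodule.mem_iInf _).mpr h)
    -- For `k ≤ k₀` the exponent `k / (k₀ + 1)` is `0` and the bound is `1`; beyond that `c` is
    -- nonzero modulo `𝔪ᵏ` and there are no zeros.
    refine ⟨1, k₀ + 1, zero_le_one, Nat.succ_pos _, fun k => ?_⟩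
    obtain hk | hk := lt_or_ge k (k₀ + 1)
    · rw [Nat.div_eq_of_lt hk]
      have h1 : Nat.card {v : Fin 0 → O ⧸ maximalIdeal O ^ k //
          MvPolynomial.aeval v (MvPolynomial.C c) = 0} ≤ 1 :=
        Finite.card_le_one_iff_subsingleton.mpr inferInstance
      simpa using! (Nat.cast_le (α := ℝ)).mpr h1
    · have : IsEmpty
          {v : Fin 0 → O ⧸ maximalIdeal O ^ k // MvPolynomial.aeval v (MvPolynomial.C c) = 0} := by
        refine ⟨fun v => hk₀ (Ideal.pow_le_pow_right (by lia : k₀ ≤ k) ?_)⟩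
        rw [← Ideal.Quotient.eq_zero_iff_mem]
        simpa using v.2
      rw [Nat.card_of_isEmpty, Nat.cast_zero]
      positivity
  | succ n ih =>
    intro Q hQ
    let f := MvPolynomial.finSuccEquiv O n Q
    have hf : f ≠ 0 := (map_ne_zero_iff _ (MvPolynomial.finSuccEquiv O n).injective).mpr hQ
    obtain ⟨C, D, hC, hD, h⟩ := ih (Polynomial.leadingCoeff_ne_zero.mpr hf)
    set d := f.natDegree with hd
    -- The new denominator makes `k / (2 * D * (d + 1))` at most both `j / D` and `i` below, the
    -- exponents of the two contributions.
    refine ⟨C + d, 2 * D * (d + 1), by positivity, by positivity, fun k => ?_⟩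
    -- View `Q` as a polynomial of degree `d` in the first variable. Where its leading coefficient
    -- vanishes modulo `𝔪ʲ`, induction applies at level `j`. Elsewhere `card_zeros_mul_le` bounds
    -- the number of first coordinates, and this choice of `i` and `j` ensures the required `d * i +
    -- j ≤ k`.
    let j := k / 2
    let i := j / (d + 1)
    have hij : (d + 1) * i ≤ j := Nat.mul_div_le j (d + 1)
    have hjk : 2 * j ≤ k := Nat.mul_div_le k 2
    have hle := Ideal.pow_le_pow_right (I := maximalIdeal O) (by lia : j ≤ k)
    let φ := (Ideal.Quotient.factor hle).toAddMonoidHom.compLeft (Fin n)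
    have hφ : Function.Surjective φ := (Ideal.Quotient.factor_surjective hle).comp_left
    let B : Set (Fin n → O ⧸ maximalIdeal O ^ k) :=
      φ ⁻¹' {v | MvPolynomial.aeval v f.leadingCoeff = 0}
    have hB : (Nat.card B : ℝ) ≤ C * q ^ (k * n) * q⁻¹ ^ (j / D) := by
      have h1 := card_preimage_mul_card φ hφ {v | MvPolynomial.aeval v f.leadingCoeff = 0}
      rw [Nat.card_fun, Nat.card_fun, card_quotient_maximalIdeal_pow,
        card_quotient_maximalIdeal_pow, Nat.card_fin, ← pow_mul, ← pow_mul] at h1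
      have h2 : (Nat.card B : ℝ) * q ^ (j * n) =
          Nat.card {v : Fin n → O ⧸ maximalIdeal O ^ j //
            MvPolynomial.aeval v f.leadingCoeff = 0} * q ^ (k * n) := by
        rw [hq]
        exact_mod_cast h1
      rw [← mul_le_mul_iff_left₀ (by positivity : 0 < q ^ (j * n)), h2]
      calc _ ≤ (C * q ^ (j * n) * q⁻¹ ^ (j / D)) * q ^ (k * n) := by gcongr; exact h j
        _ = _ := by ring
    let S : Set ((O ⧸ maximalIdeal O ^ k) × (Fin n → O ⧸ maximalIdeal O ^ k)) :=
      {z | MvPolynomial.aeval (Fin.cons z.1 z.2 : Fin (n + 1) → O ⧸ maximalIdeal O ^ k) Q = 0}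
    have hS : Nat.card {v : Fin (n + 1) → O ⧸ maximalIdeal O ^ k // MvPolynomial.aeval v Q = 0} =
        Nat.card S :=
      (Nat.card_congr ((Fin.consEquiv fun _ => O ⧸ maximalIdeal O ^ k).subtypeEquiv
        fun _ => Iff.rfl)).symm
    have key := sum_card_le S B (a := q ^ k) (c := d * q ^ k * q⁻¹ ^ i) (by positivity)
      (by rw [card_quotient_maximalIdeal_pow]; push_cast; exact le_rfl) fun v hv => by
        choose w hw using fun l => Ideal.Quotient.mk_surjective (v l)
        obtain rfl : (fun l => Ideal.Quotient.mk (maximalIdeal O ^ k) (w l)) = v := funext hw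
        let P := f.map (MvPolynomial.eval w)
        have hP : ∀ t, Polynomial.aeval t P = MvPolynomial.aeval
            (Fin.cons t fun l => Ideal.Quotient.mk (maximalIdeal O ^ k) (w l) :
              Fin (n + 1) → O ⧸ maximalIdeal O ^ k) Q := fun t => by
          obtain ⟨t, rfl⟩ := Ideal.Quotient.mk_surjective t
          have h1 := MvPolynomial.aeval_algebraMap_apply (O ⧸ maximalIdeal O ^ k)
            (Fin.cons t w : Fin (n + 1) → O) Q
          have h2 := Polynomial.aeval_algebraMap_apply (O ⧸ maximalIdeal O ^ k) t P
          rw [MvPolynomial.aeval_eq_eval, MvPolynomial.eval_eq_eval_mv_eval'] at h1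
          rw [Polynomial.coe_aeval_eq_eval] at h2
          refine h2.trans (h1.symm.trans ?_)
          congr 2
          funext l
          refine Fin.cases rfl (fun _ => rfl) l
        have h1 := card_zeros_mul_le (O := O) (P := P) (i := i) (j := j) (d := d) (k := k)
          Polynomial.natDegree_map_le (by
            rw [Polynomial.coeff_map, ← Ideal.Quotient.eq_zero_iff_mem]
            intro h0
            refine hv ?_
            have h1 := MvPolynomial.aeval_algebraMap_apply (O ⧸ maximalIdeal O ^ j) w
              f.leadingCoeff
            rw [MvPolynomial.aeval_eq_eval] at h1
            exact h1.trans h0)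
          (by lia) (by lia)
        simp_rw [hP] at h1
        have h2 : (Nat.card {t // (t, fun l => Ideal.Quotient.mk (maximalIdeal O ^ k) (w l)) ∈ S}
            : ℝ) * q ^ i ≤ d * q ^ k := by
          rw [hq]
          exact_mod_cast h1
        rwa [inv_pow, ← div_eq_mul_inv, le_div_iff₀ (by positivity)]
    rw [hS]
    refine key.trans ?_
    rw [Nat.card_fun, card_quotient_maximalIdeal_pow, Nat.card_fin, ← pow_mul, Nat.cast_pow, ← hq]
    have e1 : k / (2 * D * (d + 1)) ≤ j / D := by
      rw [mul_assoc, ← Nat.div_div_eq_div_mul]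
      exact Nat.div_le_div_left (Nat.le_mul_of_pos_right D (Nat.succ_pos d)) hD
    have e2 : k / (2 * D * (d + 1)) ≤ i := by
      rw [mul_assoc, ← Nat.div_div_eq_div_mul]
      exact Nat.div_le_div_left (Nat.le_mul_of_pos_left _ hD) (Nat.succ_pos d)
    calc q ^ k * Nat.card B + q ^ (k * n) * (d * q ^ k * q⁻¹ ^ i)
        ≤ q ^ k * (C * q ^ (k * n) * q⁻¹ ^ (k / (2 * D * (d + 1)))) +
          q ^ (k * n) * (d * q ^ k * q⁻¹ ^ (k / (2 * D * (d + 1)))) := by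
          gcongr ?_ * ?_ + ?_ * (?_ * ?_)
          · refine hB.trans ?_
            gcongr ?_ * ?_
            exact pow_le_pow_of_le_one (by positivity) hqi e1
          · exact pow_le_pow_of_le_one (by positivity) hqi e2
      _ = _ := by ring

/-- Writing `k = aD + b` with `b < D` turns the series into `D` copies of a geometric series. -/
theorem summable_pow_div {x : ℝ} (hx0 : 0 ≤ x) (hx1 : x < 1) {D : ℕ} (hD : 0 < D) :
    Summable fun k : ℕ => x ^ (k / D) := by
  have : NeZero D := ⟨hD.ne'⟩
  refine (Equiv.summable_iff (Nat.divModEquiv D).symm).mp ?_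
  have : Summable fun z : ℕ × Fin D => x ^ z.1 * 1 :=
    (summable_geometric_of_lt_one hx0 hx1).mul_of_nonneg (Summable.of_finite (f := fun _ => (1 : ℝ)))
      (fun _ => by positivity) fun _ => zero_le_one
  refine this.congr fun z => ?_
  have h : (z.2 : ℕ) / D = 0 := Nat.div_eq_of_lt z.2.2
  have h' : (z.1 * D + z.2) / D = z.1 := by
    rw [add_comm, Nat.add_mul_div_right _ _ hD, h, zero_add]
  simp [Nat.divModEquiv, h']

/-- The proportions of zeros modulo `𝔪ᵏ` of a nonzero polynomial are summable. -/
theorem summable_card_zeros {n : ℕ} {Q : MvPolynomial (Fin n) O} (hQ : Q ≠ 0) :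
    Summable fun k : ℕ =>
      (Nat.card {v : Fin n → O ⧸ maximalIdeal O ^ k // MvPolynomial.aeval v Q = 0} : ℝ) /
        (Nat.card (ResidueField O) : ℝ) ^ (k * n) := by
  have hq1 : (1 : ℝ) < Nat.card (ResidueField O) := by exact_mod_cast Finite.one_lt_card
  obtain ⟨C, D, hC, hD, h⟩ := exists_card_zeros_le n hQ
  refine Summable.of_nonneg_of_le (fun k => by positivity) (fun k => ?_)
    ((summable_pow_div (by positivity) (inv_lt_one_of_one_lt₀ hq1) hD).mul_left C)
  rw [div_le_iff₀ (by positivity)]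
  exact (h k).trans_eq (by ring)

end Counting

/-! ### Absolute value, topology and Haar measure of the local field -/

section LocalField

variable {K : Type u} [Field K] [ValuativeRel K] [TopologicalSpace K]
  [IsNonarchimedeanLocalField K]

theorem t2Space_localField : T2Space K := by
  let := IsTopologicalAddGroup.rightUniformSpace K
  have := isUniformAddGroup_of_addCommGroup (G := K)
  infer_instance

theorem isAdicComplete_integers : IsAdicComplete 𝓂[K] 𝒪[K] := by
  let := IsTopologicalAddGroup.rightUniformSpace K
  have := isUniformAddGroup_of_addCommGroup (G := K)
  infer_instance

theorem isClosed_maximalIdeal_pow (k : ℕ) : IsClosed ((𝓂[K] ^ k : Ideal 𝒪[K]) : Set 𝒪[K]) :=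
  have := t2Space_localField (K := K)
  IsNoetherianRing.isClosed_ideal _

/-- A closed subgroup of finite index is open. -/
theorem isOpen_maximalIdeal_pow (k : ℕ) : IsOpen ((𝓂[K] ^ k : Ideal 𝒪[K]) : Set 𝒪[K]) := by
  have : Finite (𝒪[K] ⧸ (𝓂[K] ^ k).toAddSubgroup) :=
    finite_quotient_maximalIdeal_pow (O := 𝒪[K]) k
  have : (𝓂[K] ^ k).toAddSubgroup.FiniteIndex := AddSubgroup.finiteIndex_of_finite_quotient
  exact (𝓂[K] ^ k).toAddSubgroup.isOpen_of_isClosed_of_finiteIndex (isClosed_maximalIdeal_pow k)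

theorem iInf_maximalIdeal_pow : ⨅ k : ℕ, 𝓂[K] ^ k = ⊥ :=
  Ideal.iInf_pow_eq_bot_of_isLocalRing _ Ideal.IsPrime.ne_top'

/-- The sets `a + 𝔪ᵏ` are nested and compact with intersection `{a}`, so one of them already lies in
`V`. -/
theorem exists_pow_subset_of_isOpen {V : Set 𝒪[K]} (hV : IsOpen V) {a : 𝒪[K]} (ha : a ∈ V) :
    ∃ k : ℕ, ∀ x : 𝒪[K], x - a ∈ 𝓂[K] ^ k → x ∈ V := by
  have hclosed : ∀ k : ℕ, IsClosed {x : 𝒪[K] | x - a ∈ 𝓂[K] ^ k} := fun k =>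
    (isClosed_maximalIdeal_pow k).preimage (continuous_id.sub continuous_const)
  obtain ⟨k, hk⟩ := exists_subset_nhds_of_isCompact'
    (V := fun k : ℕ => {x : 𝒪[K] | x - a ∈ 𝓂[K] ^ k})
    (directed_of_isDirected_le fun i j hij x hx => Ideal.pow_le_pow_right hij hx)
    (fun k => (hclosed k).isCompact) hclosed (U := V) (fun x hx => by
      have h0 : x - a ∈ ⨅ k : ℕ, 𝓂[K] ^ k := (Submodule.mem_iInf _).mpr fun k => Set.mem_iInter.mp hx k
      rw [iInf_maximalIdeal_pow, Ideal.mem_bot, sub_eq_zero] at h0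
      exact h0 ▸ hV.mem_nhds ha)
  exact ⟨k, fun x hx => hk hx⟩

open WithZero in
-- Some `y` in `K` has value `exp (-1)`. It lies in `𝔪`, so `p` divides it and `v(p) ≥ exp (-1)`;
-- since `v(p) < 1` in a value group isomorphic to `ℤ`, equality holds.
theorem valuation_irreducible {p : 𝒪[K]} (hp : Irreducible p) :
    IsNonarchimedeanLocalField.valueGroupWithZeroIsoInt K (ValuativeRel.valuation K (p : K)) =
      exp (-1) := by
  set ι := IsNonarchimedeanLocalField.valueGroupWithZeroIsoInt K
  have hint := Valuation.integer.integers (ValuativeRel.valuation K)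
  have hlt := (map_lt_map_iff ι).mpr (Valuation.integer.v_irreducible_lt_one hp)
  have hpos := (map_lt_map_iff ι).mpr (Valuation.integer.v_irreducible_pos hp)
  obtain ⟨e, he⟩ : ∃ e : ℤ, ι (ValuativeRel.valuation K (p : K)) = exp e :=
    ⟨_, (exp_log (by rw [map_zero] at hpos; exact hpos.ne')).symm⟩
  rw [map_one, he, ← exp_zero, exp_lt_exp] at hlt
  obtain ⟨y, hy⟩ := ValuativeRel.valuation_surjective (ι.symm (exp (-1)))
  have hy1 : ι (ValuativeRel.valuation K y) = exp (-1) := by rw [hy]; simp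
  have hy_lt : ValuativeRel.valuation K y < 1 := by
    rw [← map_lt_map_iff ι, hy1, map_one, ← exp_zero, exp_lt_exp]
    norm_num
  let z : 𝒪[K] := ⟨y, hy_lt.le⟩
  have hz : z ∈ 𝓂[K] := by
    rw [IsLocalRing.mem_maximalIdeal, mem_nonunits_iff, hint.isUnit_iff_valuation_eq_one]
    exact hy_lt.ne
  rw [hp.maximalIdeal_eq, Ideal.mem_span_singleton] at hz
  have hle := (map_le_map_iff ι).mpr (hint.le_of_dvd hz)
  have : exp (-1) ≤ exp e := by
    rw [← hy1, ← he]
    exact hle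
  rw [exp_le_exp] at this
  rw [he, exp_inj]
  lia

theorem normAbs_coe {k : ℕ} {x : 𝒪[K]} (h : x ∈ 𝓂[K] ^ k) (h' : x ∉ 𝓂[K] ^ (k + 1)) :
    normAbs (x : K) = ((residueCard K : ℝ) ^ k)⁻¹ := by
  obtain ⟨p, hp⟩ := IsDiscreteValuationRing.exists_irreducible 𝒪[K]
  have hx : x ≠ 0 := by
    rintro rfl
    exact h' (zero_mem _)
  obtain ⟨j, v, rfl⟩ := IsDiscreteValuationRing.eq_unit_mul_pow_irreducible hx hp
  rw [hp.maximalIdeal_eq, Ideal.span_singleton_pow, Ideal.mem_span_singleton,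
    v.isUnit.dvd_mul_left, pow_dvd_pow_iff hp.ne_zero hp.not_isUnit] at h h'
  obtain rfl : j = k := by lia
  have hv : ValuativeRel.valuation K ((v : 𝒪[K]) : K) = 1 :=
    (Valuation.integer.integers (ValuativeRel.valuation K)).valuation_unit v
  have h1 : WithZeroMulInt.toNNReal (residueCard_ne_zero K) (WithZero.exp (-1)) =
      (residueCard K : ℝ≥0)⁻¹ := by
    rw [WithZeroMulInt.toNNReal_neg_apply _ WithZero.exp_ne_zero]
    exact zpow_neg_one _
  rw [normAbs, MulMemClass.coe_mul, SubmonoidClass.coe_pow, map_mul, map_pow, hv, one_mul, map_pow,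
    map_pow, valuation_irreducible hp, h1]
  simp

/-- `K` is the union of the balls `p⁻ᵏ 𝒪`. The resulting σ-finiteness of Haar measure is what
computing product measures of boxes requires. -/
theorem sigmaCompactSpace_localField : SigmaCompactSpace K := by
  obtain ⟨p, hp⟩ := IsDiscreteValuationRing.exists_irreducible 𝒪[K]
  refine ⟨fun k => {x | ValuativeRel.valuation K x ≤ (ValuativeRel.valuation K (p : K))⁻¹ ^ k},
    fun k => IsNonarchimedeanLocalField.isCompact_closedBall K _, ?_⟩
  refine Set.eq_univ_of_forall fun x => Set.mem_iUnion.mpr ?_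
  by_cases hx : x = 0
  · exact ⟨0, by simp [hx]⟩
  set ι := IsNonarchimedeanLocalField.valueGroupWithZeroIsoInt K
  have hx0 : ι (ValuativeRel.valuation K x) ≠ 0 := by simpa using hx
  refine ⟨(WithZero.log (ι (ValuativeRel.valuation K x))).toNat, ?_⟩
  change ValuativeRel.valuation K x ≤ _
  rw [← map_le_map_iff ι, map_pow, map_inv₀, valuation_irreducible hp, ← WithZero.exp_neg,
    ← WithZero.exp_nsmul, neg_neg, nsmul_eq_mul, mul_one]
  conv_lhs => rw [← WithZero.exp_log hx0]
  rw [WithZero.exp_le_exp]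
  exact Int.self_le_toNat _

variable (K) in
/-- The ball `a + 𝔪ᵏ` in `K`. -/
def intBall (a : 𝒪[K]) (k : ℕ) : Set K := {x | ∃ y : 𝒪[K], y - a ∈ 𝓂[K] ^ k ∧ (y : K) = x}

theorem measurableSet_intBall [MeasurableSpace K] [BorelSpace K] (a : 𝒪[K]) (k : ℕ) :
    MeasurableSet (intBall K a k) := by
  have := t2Space_localField (K := K)
  have h : IsClosed {x : 𝒪[K] | x - a ∈ 𝓂[K] ^ k} :=
    (isClosed_maximalIdeal_pow k).preimage (continuous_id.sub continuous_const)
  exact (h.isCompact.image continuous_subtype_val).isClosed.measurableSet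

/-- `𝒪` has measure `1` and is the disjoint union of `qᵏ` translates of the ball, all of equal
measure. -/
theorem addHaar_intBall [MeasurableSpace K] [BorelSpace K] (a : 𝒪[K]) (k : ℕ) :
    Measure.addHaarMeasure (integersCompacts K) (intBall K a k) =
      ((residueCard K : ENNReal) ^ k)⁻¹ := by
  set μ := Measure.addHaarMeasure (integersCompacts K)
  have htrans : ∀ b : 𝒪[K], μ (intBall K b k) = μ (intBall K a k) := fun b => by
    have : intBall K b k = (fun x => ((a - b : 𝒪[K]) : K) + x) ⁻¹' intBall K a k := by
      ext x
      constructor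
      · rintro ⟨y, hy, rfl⟩
        exact ⟨a - b + y, by convert hy using 1; ring, rfl⟩
      · rintro ⟨y, hy, h⟩
        refine ⟨y - (a - b), by convert hy using 1; ring, ?_⟩
        rw [AddSubgroupClass.coe_sub, h]; ring
    rw [this, measure_preimage_add]
  have hfin := finite_quotient_maximalIdeal_pow (O := 𝒪[K]) k
  have := Fintype.ofFinite (𝒪[K] ⧸ 𝓂[K] ^ k)
  have hunion : (integersCompacts K : Set K) =
      ⋃ c : 𝒪[K] ⧸ 𝓂[K] ^ k, intBall K c.out k := by
    ext x
    rw [Set.mem_iUnion]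
    constructor
    · intro hx
      refine ⟨Ideal.Quotient.mk _ ⟨x, hx⟩, ⟨x, hx⟩, ?_, rfl⟩
      rw [← Ideal.Quotient.eq]
      exact (Quotient.out_eq _).symm
    · rintro ⟨c, y, -, rfl⟩
      exact y.2
  have hdisj : Pairwise (Function.onFun Disjoint fun c : 𝒪[K] ⧸ 𝓂[K] ^ k =>
      intBall K c.out k) := by
    intro c c' hc
    refine Set.disjoint_left.mpr ?_
    rintro _ ⟨y, hy, rfl⟩ ⟨y', hy', h⟩
    obtain rfl : y' = y := Subtype.ext h
    rw [← Ideal.Quotient.eq] at hy hy'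
    refine hc ?_
    have h1 : Ideal.Quotient.mk (𝓂[K] ^ k) c.out = c := Quotient.out_eq _
    have h2 : Ideal.Quotient.mk (𝓂[K] ^ k) c'.out = c' := Quotient.out_eq _
    rw [← h1, ← hy, hy', h2]
  have hone : μ (integersCompacts K) = 1 := Measure.addHaarMeasure_self
  rw [hunion, measure_iUnion hdisj fun c => measurableSet_intBall _ _, tsum_fintype] at hone
  simp_rw [htrans] at hone
  rw [Finset.sum_const, Finset.card_univ, ← Nat.card_eq_fintype_card,
    card_quotient_maximalIdeal_pow, nsmul_eq_mul, Nat.cast_pow] at hone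
  exact ENNReal.eq_inv_of_mul_eq_one_left (by rw [mul_comm]; exact hone)

/-- The measure of a translate of `(𝔪ᵏ)ⁿ`. -/
theorem haarPow_pi_intBall [MeasurableSpace K] [BorelSpace K] {n : ℕ} (a : Fin n → 𝒪[K]) (k : ℕ) :
    haarPow K n (Set.pi Set.univ fun i => intBall K (a i) k) =
      ((residueCard K : ENNReal) ^ (k * n))⁻¹ := by
  have := sigmaCompactSpace_localField (K := K)
  rw [haarPow, Measure.pi_pi]
  simp_rw [addHaar_intBall]
  rw [Finset.prod_const, Finset.card_univ, Fintype.card_fin, pow_mul, ← ENNReal.inv_pow]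

end LocalField

/-! ### Points with values in an algebra and their evaluations -/

section Points

variable {R : Type u} [CommRing R] {X : Scheme.{u}} {f : X ⟶ Spec (.of R)}

theorem appLE_comp_appLE_comp {X Y Z : Scheme.{u}} (f : X ⟶ Y) (g : Y ⟶ Z) {U : Z.Opens}
    {V : Y.Opens} {W : X.Opens} (e₁ : V ≤ g ⁻¹ᵁ U) (e₂ : W ≤ f ⁻¹ᵁ V) {T : CommRingCat.{u}}
    (k : Γ(X, W) ⟶ T) : g.appLE U V e₁ ≫ f.appLE V W e₂ ≫ k =
      (f ≫ g).appLE U W (e₂.trans fun _ hp => e₁ hp) ≫ k := by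
  rw [← Category.assoc, Scheme.Hom.appLE_comp_appLE]

namespace Points

variable {S S' : Type u} [CommRing S] [Algebra R S] [CommRing S'] [Algebra R S']

theorem eval_toSections (x : Points f S) {U : X.Opens} (h : x.MemOpen U) (r : R) :
    x.eval h (toSections f U r) = algebraMap R S r := by
  have key : ((Scheme.ΓSpecIso (.of R)).inv ≫ f.appLE ⊤ U (show U ≤ f ⁻¹ᵁ ⊤ from le_top)) ≫
      x.hom.appLE U ⊤ h ≫ (Scheme.ΓSpecIso (.of S)).hom =
      CommRingCat.ofHom (algebraMap R S) := by
    rw [Category.assoc, Iso.inv_comp_eq, ← Scheme.ΓSpecIso_naturality]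
    refine (appLE_comp_appLE_comp x.hom f _ _ _).trans ?_
    simp only [Scheme.Hom.appTop, Scheme.Hom.app_eq_appLE, x.w]
    rfl
  exact congrArg (fun φ => φ.hom r) key

theorem eval_res (x : Points f S) {U V : X.Opens} (hVU : V ≤ U) (hV : x.MemOpen V)
    (hU : x.MemOpen U) (g : Γ(X, U)) :
    x.eval hV (X.presheaf.map (homOfLE hVU).op g) = x.eval hU g := by
  have : X.presheaf.map (homOfLE hVU).op ≫ x.hom.appLE V ⊤ hV = x.hom.appLE U ⊤ hU :=
    Scheme.Hom.map_appLE _ _ _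
  simp only [eval, ← this]
  rfl

theorem hom_eq (x : Points f S) {U : X.Opens} (hU : IsAffineOpen U) (h : x.MemOpen U) :
    x.hom = Spec.map (CommRingCat.ofHom (x.eval h)) ≫ hU.fromSpec := by
  have := IsAffineOpen.SpecMap_appLE_fromSpec x.hom hU (isAffineOpen_top (Spec (.of S))) h
  rw [IsAffineOpen.fromSpec_top, Scheme.isoSpec_Spec_inv] at this
  simp only [eval, CommRingCat.ofHom_hom, Spec.map_comp, Category.assoc]
  rw [this, ← Spec.map_comp_assoc]
  simp

theorem ext_of_eval {x x' : Points f S} {U : X.Opens} (hU : IsAffineOpen U) (h : x.MemOpen U)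
    (h' : x'.MemOpen U) (H : ∀ g, x.eval h g = x'.eval h' g) : x = x' := by
  ext1
  rw [x.hom_eq hU h, x'.hom_eq hU h', RingHom.ext H]

/-- The point given by a ring homomorphism on an affine open. -/
theorem exists_of_ringHom {U : X.Opens} (hU : IsAffineOpen U) (φ : Γ(X, U) →+* S)
    (hφ : ∀ r, φ (toSections f U r) = algebraMap R S r) :
    ∃ (x : Points f S) (h : x.MemOpen U), x.eval h = φ := by
  let y : Spec (.of S) ⟶ X := Spec.map (CommRingCat.ofHom φ) ≫ hU.fromSpec
  have hy : (⊤ : (Spec (.of S)).Opens) ≤ y ⁻¹ᵁ U := by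
    rw [Scheme.Hom.comp_preimage, IsAffineOpen.fromSpec_preimage_self]
    exact le_rfl
  have hw : y ≫ f = Spec.map (CommRingCat.ofHom (algebraMap R S)) := by
    have h1 := IsAffineOpen.SpecMap_appLE_fromSpec f (isAffineOpen_top (Spec (.of R))) hU
      (show U ≤ f ⁻¹ᵁ ⊤ from le_top)
    rw [IsAffineOpen.fromSpec_top, Scheme.isoSpec_Spec_inv, ← Spec.map_comp] at h1
    simp only [y, Category.assoc]
    rw [← h1, ← Spec.map_comp]
    congr 1
    ext r
    exact hφ r
  let x : Points f S := ⟨y, hw⟩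
  have hx := x.hom_eq hU hy
  refine ⟨x, hy, ?_⟩
  have h2 := Spec.map_injective ((cancel_mono hU.fromSpec).mp hx)
  exact congrArg (fun ψ => ψ.hom) h2.symm

/-- The map `X(S) → X(S')` for a homomorphism `S → S'`. -/
noncomputable def map (φ : S →ₐ[R] S') (x : Points f S) : Points f S' where
  hom := Spec.map (CommRingCat.ofHom φ.toRingHom) ≫ x.hom
  w := by
    rw [Category.assoc, x.w, ← Spec.map_comp, ← CommRingCat.ofHom_comp]
    congr 2
    exact φ.comp_algebraMap

theorem reduce_eq_map (x : Points f R) : x.reduce S = x.map (Algebra.ofId R S) := rfl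

theorem map_map {S'' : Type u} [CommRing S''] [Algebra R S''] (φ : S →ₐ[R] S')
    (ψ : S' →ₐ[R] S'') (x : Points f S) : (x.map φ).map ψ = x.map (ψ.comp φ) := by
  ext1
  simp only [map]
  rw [← Spec.map_comp_assoc]
  rfl

theorem MemOpen.map {x : Points f S} {U : X.Opens} (h : x.MemOpen U) (φ : S →ₐ[R] S') :
    (x.map φ).MemOpen U := by
  intro p _
  exact h (trivial : Spec.map (CommRingCat.ofHom φ.toRingHom) p ∈ (⊤ : (Spec (.of S)).Opens))

theorem eval_map {x : Points f S} {U : X.Opens} (h : x.MemOpen U) (φ : S →ₐ[R] S')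
    (h' : (x.map φ).MemOpen U) (g : Γ(X, U)) : (x.map φ).eval h' g = φ (x.eval h g) := by
  have key : (x.map φ).hom.appLE U ⊤ h' ≫ (Scheme.ΓSpecIso (.of S')).hom =
      (x.hom.appLE U ⊤ h ≫ (Scheme.ΓSpecIso (.of S)).hom) ≫ CommRingCat.ofHom φ.toRingHom := by
    rw [Category.assoc, ← Scheme.ΓSpecIso_naturality, Scheme.Hom.appTop, Scheme.Hom.app_eq_appLE]
    exact (appLE_comp_appLE_comp (Spec.map (CommRingCat.ofHom φ.toRingHom)) x.hom h
      (le_refl _) _).symm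
  exact congrArg (fun ψ => ψ.hom g) key

/-- An open subset of the spectrum of a local ring that contains the closed point is everything. -/
theorem memOpen_iff_closedPoint [IsLocalRing S] (x : Points f S) (U : X.Opens) :
    x.MemOpen U ↔ x.hom (IsLocalRing.closedPoint S) ∈ U := by
  refine ⟨fun h => h trivial, fun h => ?_⟩
  exact ((IsLocalRing.closed_point_mem_iff (U := x.hom ⁻¹ᵁ U)).mp h).ge

theorem memOpen_map_iff [IsLocalRing S] [IsLocalRing S'] (x : Points f S) (φ : S →ₐ[R] S')
    [IsLocalHom φ.toRingHom] (U : X.Opens) : (x.map φ).MemOpen U ↔ x.MemOpen U := by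
  rw [memOpen_iff_closedPoint, memOpen_iff_closedPoint]
  have : Spec.map (CommRingCat.ofHom φ.toRingHom) (IsLocalRing.closedPoint S') =
      IsLocalRing.closedPoint S := IsLocalRing.comap_closedPoint φ.toRingHom
  rw [← this]
  rfl

theorem exists_affine_memOpen [IsLocalRing S] (x : Points f S) :
    ∃ U : X.affineOpens, x.MemOpen U.1 := by
  obtain ⟨_, ⟨U, hU, rfl⟩, hxU, -⟩ := X.isBasis_affineOpens.exists_subset_of_mem_open
    (Set.mem_univ (x.hom (IsLocalRing.closedPoint S))) isOpen_univ
  exact ⟨⟨U, hU⟩, (x.memOpen_iff_closedPoint U).mpr hxU⟩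

end Points

end Points

/-! ### Existence of coordinate charts -/

section Charts

/-- In a submersive presentation, the generators outside the range of `P.map` have differentials
forming a basis; their number is the dimension of the presentation. -/
theorem exists_basis_kaehlerDifferential (R A : Type u) [CommRing R] [CommRing A] [Algebra R A]
    (n : ℕ) [h : Algebra.IsStandardSmoothOfRelativeDimension n R A] :
    ∃ (u : Fin n → A) (b : Module.Basis (Fin n) A Ω[A⁄R]),
      ∀ i, b i = KaehlerDifferential.D R A (u i) := by
  classical
  obtain ⟨ι, σ, _, _, P, hP⟩ := h
  have := Fintype.ofFinite ι
  have := Fintype.ofFinite σ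
  have hcard : Fintype.card ((Set.range P.map)ᶜ : Set ι) = n := by
    rw [Fintype.card_compl_set, Set.card_range_of_injective P.map_inj, ← hP,
      Algebra.Presentation.dimension, Nat.card_eq_fintype_card, Nat.card_eq_fintype_card]
  let e := Fintype.equivFinOfCardEq hcard
  exact ⟨fun i => P.val (e.symm i), P.basisKaehler.reindex e, fun i => by simp⟩

variable {R : Type u} [CommRing R] {X : Scheme.{u}} (f : X ⟶ Spec (.of R)) {n : ℕ}

theorem exists_span_isStandardSmooth [SmoothOfRelativeDimension n f] (V : X.affineOpens) :
    ∃ s : Set Γ(X, V.1), Ideal.span s = ⊤ ∧ ∀ t ∈ s,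
      (toSections f (X.basicOpen t)).IsStandardSmoothOfRelativeDimension n := by
  obtain ⟨s, hs, h⟩ := HasRingHomProperty.appLE (@SmoothOfRelativeDimension n) f inferInstance
    ⟨⊤, isAffineOpen_top _⟩ V le_top
  refine ⟨s, hs, fun t ht => ?_⟩
  have := V.2.isLocalization_basicOpen t
  have hresp := RingHom.isStandardSmoothOfRelativeDimension_respectsIso (n := n)
  have h1 := hresp.2 _ (Scheme.ΓSpecIso (.of R)).commRingCatIsoToRingEquiv.symm (h t ht)
  have h2 := hresp.1 _
    (IsLocalization.algEquiv (.powers t) (Localization.Away t) Γ(X, X.basicOpen t)).toRingEquiv h1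
  have htrans : ∀ φ : R →+* Γ(X, X.basicOpen t), φ = toSections f (X.basicOpen t) →
      φ.IsStandardSmoothOfRelativeDimension n →
      (toSections f (X.basicOpen t)).IsStandardSmoothOfRelativeDimension n := by
    rintro _ rfl h
    exact h
  refine htrans _ (RingHom.ext fun r => ?_) h2
  have : toSections f (X.basicOpen t) r = algebraMap Γ(X, V.1) Γ(X, X.basicOpen t)
      (toSections f V.1 r) := by
    rw [toSections_res f (X.basicOpen_le t)]
    rfl
  rw [this]
  exact (IsLocalization.algEquiv (.powers t) (Localization.Away t)
    Γ(X, X.basicOpen t)).commutes _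

theorem exists_span_chart [SmoothOfRelativeDimension n f] (V : X.affineOpens) :
    ∃ s : Set Γ(X, V.1), Ideal.span s = ⊤ ∧ ∀ t ∈ s,
      ∃ c : CoordinateChart f n, c.U = ⟨X.basicOpen t, V.2.basicOpen t⟩ := by
  obtain ⟨s, hs, h⟩ := exists_span_isStandardSmooth (n := n) f V
  refine ⟨s, hs, fun t ht => ?_⟩
  let := sectionsAlgebra f (X.basicOpen t)
  have : Algebra.IsStandardSmoothOfRelativeDimension n R Γ(X, X.basicOpen t) := h t ht
  obtain ⟨u, hu⟩ := exists_basis_kaehlerDifferential R Γ(X, X.basicOpen t) n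
  exact ⟨⟨⟨X.basicOpen t, V.2.basicOpen t⟩, u, hu⟩, rfl⟩

theorem exists_chart [SmoothOfRelativeDimension n f] (p : X) :
    ∃ c : CoordinateChart f n, p ∈ c.U.1 := by
  obtain ⟨_, ⟨V, hV, rfl⟩, hp, -⟩ := X.isBasis_affineOpens.exists_subset_of_mem_open
    (Set.mem_univ p) isOpen_univ
  obtain ⟨s, hs, h⟩ := exists_span_chart (n := n) f ⟨V, hV⟩
  rw [← IsAffineOpen.iSup_basicOpen_eq_self_iff hV] at hs
  rw [SetLike.mem_coe, ← hs] at hp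
  obtain ⟨t, ht⟩ := TopologicalSpace.Opens.mem_iSup.mp hp
  obtain ⟨c, hc⟩ := h t.1 t.2
  exact ⟨c, hc ▸ ht⟩

variable {f}

/-- The restriction of a coordinate chart to a basic open subset. -/
noncomputable def CoordinateChart.basicOpen (c : CoordinateChart f n) (g : Γ(X, c.U.1)) :
    CoordinateChart f n where
  U := ⟨X.basicOpen g, c.U.2.basicOpen g⟩
  u := fun i => X.presheaf.map (homOfLE (X.basicOpen_le g)).op (c.u i)
  isBasis := by
    let := sectionsAlgebra f c.U.1
    let := sectionsAlgebra f (X.basicOpen g)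
    let : Algebra Γ(X, c.U.1) Γ(X, X.basicOpen g) :=
      (X.presheaf.map (homOfLE (X.basicOpen_le g)).op).hom.toAlgebra
    have : IsScalarTower R Γ(X, c.U.1) Γ(X, X.basicOpen g) :=
      IsScalarTower.of_algebraMap_eq' (toSections_res f (X.basicOpen_le g))
    have : IsLocalization.Away g Γ(X, X.basicOpen g) := c.U.2.isLocalization_basicOpen g
    obtain ⟨b, hb⟩ := c.isBasis
    refine ⟨b.ofIsLocalizedModule Γ(X, X.basicOpen g) (.powers g)
      (KaehlerDifferential.map R R Γ(X, c.U.1) Γ(X, X.basicOpen g)), fun i => ?_⟩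
    rw [Module.Basis.ofIsLocalizedModule_apply, hb, KaehlerDifferential.map_D]
    rfl

theorem formallySmooth_sections [SmoothOfRelativeDimension n f] (V : X.affineOpens) :
    @Algebra.FormallySmooth R Γ(X, V.1) _ _ (sectionsAlgebra f V.1) := by
  have := SmoothOfRelativeDimension.smooth n f
  have h := f.smooth_appLE (isAffineOpen_top _) V.2 le_top
  have h1 := RingHom.Smooth.propertyIsLocal.respectsIso.2 _
    (Scheme.ΓSpecIso (.of R)).commRingCatIsoToRingEquiv.symm h
  let := sectionsAlgebra f V.1
  have : Algebra.Smooth R Γ(X, V.1) := h1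
  infer_instance

theorem finiteType_sections [SmoothOfRelativeDimension n f] (V : X.affineOpens) :
    @Algebra.FiniteType R Γ(X, V.1) _ _ (sectionsAlgebra f V.1) := by
  have := SmoothOfRelativeDimension.smooth n f
  have h := f.smooth_appLE (isAffineOpen_top _) V.2 le_top
  have h1 := RingHom.Smooth.propertyIsLocal.respectsIso.2 _
    (Scheme.ΓSpecIso (.of R)).commRingCatIsoToRingEquiv.symm h
  let := sectionsAlgebra f V.1
  have : Algebra.Smooth R Γ(X, V.1) := h1
  infer_instance

end Charts

/-! ### Vanishing of a form at a point, read off in a chart -/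

section TensorVanishing

variable {R A B S : Type u} [CommRing R] [CommRing A] [CommRing B] [CommRing S]
  [Algebra R A] [Algebra R B] [Algebra A B] [IsScalarTower R A B] [Algebra A S] [Algebra B S]
  [IsScalarTower A B S] {n r : ℕ}

theorem one_tmul_formMap_eq_zero {m : FormModule R A n r} (h : (1 : S) ⊗ₜ[A] m = 0) :
    (1 : S) ⊗ₜ[B] formMap R A B n r m = 0 := by
  have := congrArg (TensorProduct.mapOfCompatibleSMul B A A S (FormModule R B n r))
    (congrArg (LinearMap.lTensor S (formMap R A B n r)) h)
  simpa using this

theorem one_tmul_smul_eq_zero_iff (b : Module.Basis (Fin n) A Ω[A⁄R]) (a : A) :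
    (1 : S) ⊗ₜ[A] (a • PiTensorProduct.tprod A fun _ => exteriorPower.ιMulti A n fun i => b i :
      FormModule R A n r) = 0 ↔ algebraMap A S a = 0 := by
  constructor
  · intro h
    rw [← formBasis_default] at h
    have := congrArg (TensorProduct.rid A S)
      (congrArg (LinearMap.lTensor S ((formBasis r b).coord default)) h)
    simpa [Algebra.smul_def] using this
  · intro h
    rw [← TensorProduct.smul_tmul, Algebra.smul_def, h, zero_mul, TensorProduct.zero_tmul]

end TensorVanishing

section Vanishing

variable {R : Type u} [CommRing R] {X : Scheme.{u}} {f : X ⟶ Spec (.of R)} {n r : ℕ}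

theorem CoordinateChart.exists_eq_smul_duPow (c : CoordinateChart f n)
    (ω : AffineForms f n r c.U) : ∃ a : Γ(X, c.U.1), ω = a • c.duPow r := by
  let := sectionsAlgebra f c.U.1
  obtain ⟨b, hb⟩ := c.isBasis
  obtain ⟨a, ha⟩ := exists_eq_smul_tprod b ω
  simp only [hb] at ha
  exact ⟨a, ha⟩

theorem CoordinateChart.smul_duPow_eq_zero (c : CoordinateChart f n) {a : Γ(X, c.U.1)}
    (h : a • c.duPow r = 0) : a = 0 := by
  let := sectionsAlgebra f c.U.1
  obtain ⟨b, hb⟩ := c.isBasis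
  refine smul_tprod_eq_zero (r := r) b (a := a) ?_
  simp only [hb]
  exact h

theorem CoordinateChart.res_smul_duPow (c : CoordinateChart f n) (g a : Γ(X, c.U.1)) :
    AffineForms.res f n r (U := c.U) (V := (c.basicOpen g).U) (X.basicOpen_le g)
      (a • c.duPow r) =
    X.presheaf.map (homOfLE (show (c.basicOpen g).U.1 ≤ c.U.1 from X.basicOpen_le g)).op a •
      (c.basicOpen g).duPow r := by
  let := sectionsAlgebra f c.U.1
  let := sectionsAlgebra f (X.basicOpen g)
  let : Algebra Γ(X, c.U.1) Γ(X, X.basicOpen g) :=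
    (X.presheaf.map (homOfLE (X.basicOpen_le g)).op).hom.toAlgebra
  have : IsScalarTower R Γ(X, c.U.1) Γ(X, X.basicOpen g) :=
    IsScalarTower.of_algebraMap_eq' (toSections_res f (X.basicOpen_le g))
  have h1 : formMap R Γ(X, c.U.1) Γ(X, X.basicOpen g) n r (c.duPow r) =
      (c.basicOpen g).duPow r := by
    rw [CoordinateChart.duPow, formMap_tprod_ιMulti]
    simp_rw [KaehlerDifferential.map_D]
    rfl
  change formMap R Γ(X, c.U.1) Γ(X, X.basicOpen g) n r (a • c.duPow r) = _
  rw [map_smul, h1]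
  exact (algebraMap_smul Γ(X, X.basicOpen g) a
    (show FormModule R Γ(X, X.basicOpen g) n r from (c.basicOpen g).duPow r)).symm

theorem CoordinateChart.one_tmul_eq_zero_iff (c : CoordinateChart f n) {S : Type u} [CommRing S]
    [Algebra R S] (x : Points f S) (h : x.MemOpen c.U.1) (a : Γ(X, c.U.1)) :
    (letI : Algebra Γ(X, c.U.1) S := (x.eval h).toAlgebra
     (1 : S) ⊗ₜ[Γ(X, c.U.1)] (a • c.duPow r) = 0) ↔ x.eval h a = 0 := by
  let := sectionsAlgebra f c.U.1
  let : Algebra Γ(X, c.U.1) S := (x.eval h).toAlgebra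
  obtain ⟨b, hb⟩ := c.isBasis
  have := one_tmul_smul_eq_zero_iff (S := S) (r := r) b a
  simp only [hb] at this
  exact this

theorem one_tmul_eq_zero_of_le (α : PluricanonicalForms f n r) {S : Type u} [CommRing S]
    [Algebra R S] (x : Points f S) {U V : X.affineOpens} (hVU : V.1 ≤ U.1) (hU : x.MemOpen U.1)
    (hV : x.MemOpen V.1)
    (h : letI : Algebra Γ(X, U.1) S := (x.eval hU).toAlgebra
      (1 : S) ⊗ₜ[Γ(X, U.1)] (α.1 U) = 0) :
    letI : Algebra Γ(X, V.1) S := (x.eval hV).toAlgebra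
    (1 : S) ⊗ₜ[Γ(X, V.1)] (α.1 V) = 0 := by
  let := sectionsAlgebra f U.1
  let := sectionsAlgebra f V.1
  let : Algebra Γ(X, U.1) Γ(X, V.1) := (X.presheaf.map (homOfLE hVU).op).hom.toAlgebra
  have : IsScalarTower R Γ(X, U.1) Γ(X, V.1) :=
    IsScalarTower.of_algebraMap_eq' (toSections_res f hVU)
  let : Algebra Γ(X, U.1) S := (x.eval hU).toAlgebra
  let : Algebra Γ(X, V.1) S := (x.eval hV).toAlgebra
  have : IsScalarTower Γ(X, U.1) Γ(X, V.1) S :=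
    IsScalarTower.of_algebraMap_eq fun g => (x.eval_res hVU hV hU g).symm
  have h1 := one_tmul_formMap_eq_zero (B := Γ(X, V.1)) h
  rw [← α.2 U V hVU]
  exact h1

/-- A form vanishes at a point if and only if its coefficient in a chart does. -/
theorem vanishesAt_iff (α : PluricanonicalForms f n r) {S : Type u} [CommRing S] [IsLocalRing S]
    [Algebra R S] (x : Points f S) (c : CoordinateChart f n) (h : x.MemOpen c.U.1)
    {a : Γ(X, c.U.1)} (ha : α.1 c.U = a • c.duPow r) : VanishesAt α x ↔ x.eval h a = 0 := by
  constructor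
  · rintro ⟨U, hU, h0⟩
    -- The open set witnessing the vanishing is unrelated to the chart. Both are compared on a
    -- common basic open neighbourhood of the image of the closed point.
    obtain ⟨g, g', hg, hp⟩ := exists_basicOpen_le_affine_inter U.2 c.U.2
      (x.hom (IsLocalRing.closedPoint S))
      ⟨(x.memOpen_iff_closedPoint _).mp hU, (x.memOpen_iff_closedPoint _).mp h⟩
    have hV : x.MemOpen (X.basicOpen g') := (x.memOpen_iff_closedPoint _).mpr (hg ▸ hp)
    have h1 := one_tmul_eq_zero_of_le α x (V := (c.basicOpen g').U)
      (show X.basicOpen g' ≤ U.1 from hg ▸ X.basicOpen_le g) hU hV h0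
    rw [← α.2 c.U (c.basicOpen g').U (X.basicOpen_le g'), ha, c.res_smul_duPow] at h1
    have h2 := ((c.basicOpen g').one_tmul_eq_zero_iff x hV _).mp h1
    exact (x.eval_res (X.basicOpen_le g') hV h a).symm.trans h2
  · intro h0
    exact ⟨c.U, h, by rw [ha]; exact (c.one_tmul_eq_zero_iff x h a).mpr h0⟩

end Vanishing

/-! ### A nonzero form is nonzero on every nonempty chart -/

section Nonvanishing

variable {R : Type u} [CommRing R] {X : Scheme.{u}} [IsIntegral X] {f : X ⟶ Spec (.of R)}
  {n r : ℕ}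

theorem isDomain_sections {U : X.Opens} {p : X} (hp : p ∈ U) : IsDomain Γ(X, U) :=
  have : Nonempty U := ⟨⟨p, hp⟩⟩
  inferInstance

theorem eq_zero_of_res_eq_zero {U V : X.Opens} (hVU : V ≤ U) {p : X} (hp : p ∈ V) {a : Γ(X, U)}
    (h : X.presheaf.map (homOfLE hVU).op a = 0) : a = 0 := by
  have : Nonempty V := ⟨⟨p, hp⟩⟩
  exact (map_eq_zero_iff _ (map_injective_of_isIntegral X (homOfLE hVU))).mp h

/-- Nonempty opens of an irreducible scheme meet. On a common basic open set the coefficient in `c₁`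
vanishes, and restriction is injective on an integral scheme. -/
theorem coefficient_eq_zero (α : PluricanonicalForms f n r) (c c₁ : CoordinateChart f n) {p : X}
    (hp : p ∈ c.U.1) (h0 : α.1 c.U = 0) : α.1 c₁.U = 0 := by
  obtain ⟨a, ha⟩ := c₁.exists_eq_smul_duPow (α.1 c₁.U)
  suffices a = 0 by rw [ha, this, zero_smul]
  by_cases hne : (c₁.U.1 : Set X).Nonempty
  · obtain ⟨p', hp'⟩ := nonempty_preirreducible_inter c.U.1.2 c₁.U.1.2 ⟨p, hp⟩ hne
    obtain ⟨g, g', hg, hpg⟩ := exists_basicOpen_le_affine_inter c.U.2 c₁.U.2 p' hp'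
    have hle : X.basicOpen g' ≤ c.U.1 := hg ▸ X.basicOpen_le g
    have h1 := α.2 c.U (c₁.basicOpen g').U hle
    rw [h0, map_zero, ← α.2 c₁.U (c₁.basicOpen g').U (X.basicOpen_le g'), ha,
      c₁.res_smul_duPow] at h1
    exact eq_zero_of_res_eq_zero (X.basicOpen_le g') (hg ▸ hpg)
      ((c₁.basicOpen g').smul_duPow_eq_zero h1.symm)
  · have hbot : c₁.U.1 = ⊥ := TopologicalSpace.Opens.ext (Set.not_nonempty_iff_eq_empty.mp hne)
    have : Subsingleton Γ(X, c₁.U.1) := by rw [hbot]; infer_instance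
    exact Subsingleton.elim _ _

/-- Any affine `V` is covered by basic opens `D(t)` carrying charts. On each the form vanishes, so a
power of `t` kills it on `V`; as the `t` generate the unit ideal, it is zero. -/
theorem eq_zero_of_eq_zero_on_chart [SmoothOfRelativeDimension n f]
    (α : PluricanonicalForms f n r) (c : CoordinateChart f n) {p : X}
    (hp : p ∈ c.U.1) (h0 : α.1 c.U = 0) : α = 0 := by
  ext V : 2
  change α.1 V = 0
  obtain ⟨s, hs, h⟩ := exists_span_chart (n := n) f V
  refine (Submodule.mem_bot Γ(X, V.1)).mp
    (Submodule.mem_of_span_eq_top_of_smul_pow_mem _ s hs _ fun t => ?_)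
  obtain ⟨c', hc'⟩ := h t.1 t.2
  have h1 := coefficient_eq_zero α c c' hp h0
  by_cases ht : t.1 = 0
  · exact ⟨1, by simp [ht]⟩
  have hne : (V.1 : Set X).Nonempty := by
    by_contra hne
    have hbot : V.1 = ⊥ := TopologicalSpace.Opens.ext (Set.not_nonempty_iff_eq_empty.mp hne)
    have : Subsingleton Γ(X, V.1) := by rw [hbot]; infer_instance
    exact ht (Subsingleton.elim _ _)
  obtain ⟨p', hp'⟩ := hne
  have := isDomain_sections hp'
  let := sectionsAlgebra f V.1
  let := sectionsAlgebra f (X.basicOpen t.1)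
  let : Algebra Γ(X, V.1) Γ(X, X.basicOpen t.1) :=
    (X.presheaf.map (homOfLE (X.basicOpen_le t.1)).op).hom.toAlgebra
  have : IsScalarTower R Γ(X, V.1) Γ(X, X.basicOpen t.1) :=
    IsScalarTower.of_algebraMap_eq' (toSections_res f (X.basicOpen_le t.1))
  have : IsLocalization.Away t.1 Γ(X, X.basicOpen t.1) := V.2.isLocalization_basicOpen t.1
  have hbasis (W : X.affineOpens) (hW : c'.U = W) : letI := sectionsAlgebra f W.1
      Nonempty (Module.Basis (Fin n) Γ(X, W.1) Ω[Γ(X, W.1)⁄R]) := by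
    subst hW
    exact ⟨c'.isBasis.choose⟩
  rw [hc'] at h1
  have h2 : formMap R Γ(X, V.1) Γ(X, X.basicOpen t.1) n r (α.1 V) = 0 :=
    (α.2 V ⟨X.basicOpen t.1, V.2.basicOpen t.1⟩ (X.basicOpen_le t.1)).trans h1
  obtain ⟨N, hN⟩ := exists_pow_smul_eq_zero_of_formMap_eq_zero ht (hbasis _ hc').some h2
  exact ⟨N, (Submodule.mem_bot _).mpr hN⟩

end Nonvanishing

/-! ### Lifting points and finiteness of point sets -/

section Lifting

variable {R : Type u} [CommRing R] {X : Scheme.{u}} {f : X ⟶ Spec (.of R)} {n : ℕ}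
  {S S' : Type u} [CommRing S] [Algebra R S] [CommRing S'] [Algebra R S']

/-- Two points with the same reduction and the same coordinates are equal. -/
theorem CoordinateChart.point_ext [SmoothOfRelativeDimension n f] (c : CoordinateChart f n)
    (φ : S →ₐ[R] S') (hφ : ⨅ k : ℕ, RingHom.ker φ ^ k = ⊥) {x x' : Points f S}
    (h : x.MemOpen c.U.1) (h' : x'.MemOpen c.U.1) (hmap : x.map φ = x'.map φ)
    (hu : ∀ i, x.eval h (c.u i) = x'.eval h' (c.u i)) : x = x' := by
  let := sectionsAlgebra f c.U.1
  have := formallySmooth_sections (n := n) (f := f) c.U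
  obtain ⟨b, hb⟩ := c.isBasis
  let g : Γ(X, c.U.1) →ₐ[R] S := ⟨x.eval h, x.eval_toSections h⟩
  let g' : Γ(X, c.U.1) →ₐ[R] S := ⟨x'.eval h', x'.eval_toSections h'⟩
  have hg : g = g' := by
    refine algHom_ext_of_coordinates b hb (RingHom.ker φ) hφ g g' (fun a => ?_) hu
    rw [Ideal.Quotient.eq, RingHom.mem_ker, map_sub, sub_eq_zero]
    change φ (x.eval h a) = φ (x'.eval h' a)
    rw [← Points.eval_map h φ (h.map φ), ← Points.eval_map h' φ (h'.map φ)]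
    congr! 2
  exact Points.ext_of_eval c.U.2 h h' fun a => congrArg (fun ψ : Γ(X, c.U.1) →ₐ[R] S => ψ a) hg

/-- Points lift along surjections with complete kernel, with prescribed coordinates. -/
theorem CoordinateChart.exists_point [SmoothOfRelativeDimension n f] (c : CoordinateChart f n)
    (φ : S →ₐ[R] S') (hφ : Function.Surjective φ) [IsAdicComplete (RingHom.ker φ) S]
    (y : Points f S') (hy : y.MemOpen c.U.1) (v : Fin n → S)
    (hv : ∀ i, φ (v i) = y.eval hy (c.u i)) :
    ∃ (x : Points f S) (h : x.MemOpen c.U.1), x.map φ = y ∧ ∀ i, x.eval h (c.u i) = v i := by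
  let := sectionsAlgebra f c.U.1
  have := formallySmooth_sections (n := n) (f := f) c.U
  obtain ⟨b, hb⟩ := c.isBasis
  let e : (S ⧸ RingHom.ker φ) ≃ₐ[R] S' := Ideal.quotientKerAlgEquivOfSurjective hφ
  have he : ∀ s, e (Ideal.Quotient.mk _ s) = φ s := fun s => rfl
  let g : Γ(X, c.U.1) →ₐ[R] S' := ⟨y.eval hy, y.eval_toSections hy⟩
  obtain ⟨G, hG, hGu⟩ := exists_algHom_of_coordinates b hb (RingHom.ker φ)
    (e.symm.toAlgHom.comp g) v fun i => by
      apply e.injective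
      rw [he, hv]
      exact (e.apply_symm_apply _).symm
  obtain ⟨x, h, hx⟩ := Points.exists_of_ringHom (f := f) (S := S) c.U.2 G.toRingHom G.commutes
  refine ⟨x, h, Points.ext_of_eval c.U.2 (h.map φ) hy fun a => ?_, fun i => ?_⟩
  · rw [Points.eval_map h, hx]
    change φ (G a) = _
    rw [← he, hG]
    exact e.apply_symm_apply _
  · rw [hx]
    exact hGu i

/-- Points of the base change to `S` are points of the scheme. -/
noncomputable def pointsPullbackEquiv (S : Type u) [CommRing S] [Algebra R S] :
    Points (Limits.pullback.snd f (Spec.map (CommRingCat.ofHom (algebraMap R S)))) S ≃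
      Points f S where
  toFun x := ⟨x.hom ≫ Limits.pullback.fst _ _, by
    rw [Category.assoc, Limits.pullback.condition, ← Category.assoc, x.w, ← Spec.map_comp]
    rfl⟩
  invFun x := ⟨Limits.pullback.lift x.hom (𝟙 _) (by rw [x.w, Category.id_comp]), by
    rw [Limits.pullback.lift_snd]
    exact (Spec.map_id _).symm⟩
  left_inv x := by
    ext1
    apply Limits.pullback.hom_ext
    · rw [Limits.pullback.lift_fst]
    · rw [Limits.pullback.lift_snd, x.w]
      exact (Spec.map_id _).symm
  right_inv x := by
    ext1
    exact Limits.pullback.lift_fst _ _ _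

/-- Quasi-compactness is what the counting and the measure need: it makes the sets `X(𝒪/𝔪ᵏ⁺¹)` and
`X(𝔽_q)` finite. -/
theorem IsProjective.compactSpace (hf : IsProjective f) : CompactSpace X := by
  obtain ⟨N, i, hi, -⟩ := hf
  let := MvPolynomial.gradedAlgebra (σ := Fin (N + 1)) (R := R)
  let 𝒜 := MvPolynomial.homogeneousSubmodule (Fin (N + 1)) R
  have : IsScalarTower R (𝒜 0) (MvPolynomial (Fin (N + 1)) R) :=
    ⟨fun r x y => smul_mul_assoc r x.1 y⟩
  have : Algebra.FiniteType (𝒜 0) (MvPolynomial (Fin (N + 1)) R) :=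
    Algebra.FiniteType.of_restrictScalars_finiteType R _ _
  have : CompactSpace (Proj 𝒜) :=
    QuasiCompact.compactSpace_of_compactSpace (Proj.toSpecZero 𝒜)
  exact QuasiCompact.compactSpace_of_compactSpace i

/-- A quasi-compact smooth scheme has finitely many points with values in a finite local ring. -/
theorem finite_points [SmoothOfRelativeDimension n f] [CompactSpace X] [IsLocalRing S]
    [Finite S] : Finite (Points f S) := by
  classical
  have hfin (U : X.affineOpens) : {x : Points f S | x.MemOpen U.1}.Finite := by
    let := sectionsAlgebra f U.1
    have := finiteType_sections (n := n) (f := f) U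
    obtain ⟨t, ht⟩ := Algebra.FiniteType.out (R := R) (A := Γ(X, U.1))
    let F : {x : Points f S | x.MemOpen U.1} → (t → S) := fun x a => x.1.eval x.2 a
    refine Set.finite_coe_iff.mp (Finite.of_injective F fun x x' hx => ?_)
    let g : Γ(X, U.1) →ₐ[R] S := ⟨x.1.eval x.2, x.1.eval_toSections x.2⟩
    let g' : Γ(X, U.1) →ₐ[R] S := ⟨x'.1.eval x'.2, x'.1.eval_toSections x'.2⟩
    have hg : g = g' := AlgHom.ext_of_adjoin_eq_top ht fun a ha => congrFun hx ⟨a, ha⟩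
    exact Subtype.ext (Points.ext_of_eval U.2 x.2 x'.2 fun a =>
      congrArg (fun ψ : Γ(X, U.1) →ₐ[R] S => ψ a) hg)
  obtain ⟨t, ht⟩ := isCompact_univ.elim_finite_subcover
    (fun U : X.affineOpens => (U.1 : Set X)) (fun U => U.1.2) fun p _ => by
      obtain ⟨_, ⟨U, hU, rfl⟩, hp, -⟩ := X.isBasis_affineOpens.exists_subset_of_mem_open
        (Set.mem_univ p) isOpen_univ
      exact Set.mem_iUnion.mpr ⟨⟨U, hU⟩, hp⟩
  refine Set.finite_univ_iff.mp ((Set.Finite.biUnion t.finite_toSet fun U _ => hfin U).subset ?_)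
  intro x _
  obtain ⟨U, hU, hp⟩ := Set.mem_iUnion₂.mp (ht (Set.mem_univ (x.hom (IsLocalRing.closedPoint S))))
  exact Set.mem_biUnion hU ((x.memOpen_iff_closedPoint _).mpr hp)

end Lifting

/-! ### Reduction of integral points modulo powers of `𝔪` -/

section Reduction

variable {R : Type u} [CommRing R] {X : Scheme.{u}} {f : X ⟶ Spec (.of R)} {n : ℕ}

theorem Points.eval_reduce {S : Type u} [CommRing S] [Algebra R S] {x : Points f R}
    {U : X.Opens} (h : x.MemOpen U) (h' : (x.reduce S).MemOpen U) (g : Γ(X, U)) :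
    (x.reduce S).eval h' g = algebraMap R S (x.eval h g) :=
  Points.eval_map h (Algebra.ofId R S) h' g

theorem Points.MemOpen.reduce {S : Type u} [CommRing S] [Algebra R S] {x : Points f R}
    {U : X.Opens} (h : x.MemOpen U) : (x.reduce S).MemOpen U := h.map (Algebra.ofId R S)

theorem CoordinateChart.exists_memOpen [SmoothOfRelativeDimension n f] {S : Type u} [CommRing S] [IsLocalRing S]
    [Algebra R S] (x : Points f S) : ∃ c : CoordinateChart f n, x.MemOpen c.U.1 := by
  obtain ⟨c, hc⟩ := exists_chart (n := n) f (x.hom (IsLocalRing.closedPoint S))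
  exact ⟨c, (x.memOpen_iff_closedPoint _).mpr hc⟩

end Reduction

section LocalFieldPoints

variable {K : Type u} [Field K] [ValuativeRel K] [TopologicalSpace K]
  [IsNonarchimedeanLocalField K]

/-- Levels are indexed by `k + 1` from here on, since `𝒪/𝔪⁰` is the zero ring. -/
instance isLocalRing_quotient_pow (k : ℕ) : IsLocalRing (𝒪[K] ⧸ 𝓂[K] ^ (k + 1)) :=
  have : Nontrivial (𝒪[K] ⧸ 𝓂[K] ^ (k + 1)) := Ideal.Quotient.nontrivial_iff.mpr fun h =>
    Ideal.IsPrime.ne_top' (top_le_iff.mp (h.ge.trans (Ideal.pow_le_self k.succ_ne_zero)))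
  IsLocalRing.of_surjective' (Ideal.Quotient.mk _) Ideal.Quotient.mk_surjective

instance finite_quotient_pow (k : ℕ) : Finite (𝒪[K] ⧸ 𝓂[K] ^ k) :=
  finite_quotient_maximalIdeal_pow (O := 𝒪[K]) k

theorem ker_ofId_residue : RingHom.ker (Algebra.ofId 𝒪[K] 𝓀[K]) = 𝓂[K] :=
  IsLocalRing.ker_residue

variable (K) in
/-- The residue map `𝒪 ⧸ 𝔪ᵏ⁺¹ → 𝒪 ⧸ 𝔪`. -/
noncomputable def quotientToResidue (k : ℕ) : 𝒪[K] ⧸ 𝓂[K] ^ (k + 1) →ₐ[𝒪[K]] 𝓀[K] :=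
  Ideal.Quotient.liftₐ _ (Algebra.ofId 𝒪[K] 𝓀[K]) fun _ ha =>
    (IsLocalRing.residue_eq_zero_iff _).mpr (Ideal.pow_le_self k.succ_ne_zero ha)

theorem quotientToResidue_mk (k : ℕ) (a : 𝒪[K]) :
    quotientToResidue K k (Ideal.Quotient.mk _ a) = algebraMap 𝒪[K] 𝓀[K] a := rfl

theorem surjective_quotientToResidue (k : ℕ) : Function.Surjective (quotientToResidue K k) :=
  fun b => by
    obtain ⟨a, rfl⟩ := IsLocalRing.residue_surjective b
    exact ⟨Ideal.Quotient.mk _ a, rfl⟩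

instance (k : ℕ) : IsLocalHom (quotientToResidue K k).toRingHom :=
  (surjective_quotientToResidue k).isLocalHom

instance : IsLocalHom (Algebra.ofId 𝒪[K] 𝓀[K]).toRingHom :=
  (IsLocalRing.residue_surjective (R := 𝒪[K])).isLocalHom

/-- The kernel is `𝔪/𝔪ᵏ⁺¹`, which is nilpotent. Hence points over `𝒪/𝔪ᵏ⁺¹` are also determined by
their residue point and coordinates. -/
theorem iInf_ker_quotientToResidue_pow (k : ℕ) :
    ⨅ j : ℕ, RingHom.ker (quotientToResidue K k) ^ j = ⊥ := by
  refine le_bot_iff.mp ((iInf_le _ (k + 1)).trans ?_)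
  have h : RingHom.ker (quotientToResidue K k) = 𝓂[K].map (Ideal.Quotient.mk (𝓂[K] ^ (k + 1))) := by
    ext a
    obtain ⟨a, rfl⟩ := Ideal.Quotient.mk_surjective a
    rw [RingHom.mem_ker, quotientToResidue_mk]
    constructor
    · exact fun h => Ideal.mem_map_of_mem _ ((IsLocalRing.residue_eq_zero_iff a).mp h)
    · intro h
      obtain ⟨b, hb, hab⟩ := (Ideal.mem_map_iff_of_surjective _ Ideal.Quotient.mk_surjective).mp h
      rw [← quotientToResidue_mk k, ← hab]
      exact (IsLocalRing.residue_eq_zero_iff b).mpr hb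
  rw [h, ← Ideal.map_pow, Ideal.map_quotient_self]

variable {X : Scheme.{u}} {f : X ⟶ Spec (.of 𝒪[K])} {n : ℕ}

theorem Points.memOpen_reduce_residue (x : Points f 𝒪[K]) (U : X.Opens) :
    (x.reduce 𝓀[K]).MemOpen U ↔ x.MemOpen U :=
  x.memOpen_map_iff (Algebra.ofId 𝒪[K] 𝓀[K]) U

theorem Points.map_quotientToResidue (x : Points f 𝒪[K]) (k : ℕ) :
    (x.reduce (𝒪[K] ⧸ 𝓂[K] ^ (k + 1))).map (quotientToResidue K k) = x.reduce 𝓀[K] := by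
  rw [Points.reduce_eq_map, Points.map_map]
  rfl

theorem Points.memOpen_map_quotientToResidue {k : ℕ} (x : Points f (𝒪[K] ⧸ 𝓂[K] ^ (k + 1)))
    (U : X.Opens) : (x.map (quotientToResidue K k)).MemOpen U ↔ x.MemOpen U :=
  x.memOpen_map_iff (quotientToResidue K k) U

theorem Points.reduce_eq_of_le {x x' : Points f 𝒪[K]} {j k : ℕ} (hjk : j ≤ k)
    (h : x.reduce (𝒪[K] ⧸ 𝓂[K] ^ (k + 1)) = x'.reduce (𝒪[K] ⧸ 𝓂[K] ^ (k + 1))) :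
    x.reduce (𝒪[K] ⧸ 𝓂[K] ^ (j + 1)) = x'.reduce (𝒪[K] ⧸ 𝓂[K] ^ (j + 1)) := by
  let φ : 𝒪[K] ⧸ 𝓂[K] ^ (k + 1) →ₐ[𝒪[K]] 𝒪[K] ⧸ 𝓂[K] ^ (j + 1) :=
    Ideal.Quotient.factorₐ _ (Ideal.pow_le_pow_right (Nat.succ_le_succ hjk))
  have := congrArg (Points.map φ) h
  rw [Points.reduce_eq_map, Points.reduce_eq_map, Points.map_map, Points.map_map] at this
  rw [Points.reduce_eq_map, Points.reduce_eq_map]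
  rwa [Subsingleton.elim (φ.comp (Algebra.ofId _ _)) (Algebra.ofId _ _)] at this

namespace CoordinateChart

/-- The coordinates of a chart identify each fibre of the reduction map with a translate
of `𝔪ⁿ`. -/
theorem exists_integral_point [SmoothOfRelativeDimension n f] (c : CoordinateChart f n)
    (y : Points f 𝓀[K]) (hy : y.MemOpen c.U.1) (v : Fin n → 𝒪[K])
    (hv : ∀ i, algebraMap 𝒪[K] 𝓀[K] (v i) = y.eval hy (c.u i)) :
    ∃ (x : Points f 𝒪[K]) (h : x.MemOpen c.U.1), x.reduce 𝓀[K] = y ∧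
      ∀ i, x.eval h (c.u i) = v i := by
  have : IsAdicComplete (RingHom.ker (Algebra.ofId 𝒪[K] 𝓀[K])) 𝒪[K] := by
    rw [ker_ofId_residue]
    exact isAdicComplete_integers
  exact c.exists_point (Algebra.ofId 𝒪[K] 𝓀[K]) IsLocalRing.residue_surjective y hy v hv

theorem integral_point_ext [SmoothOfRelativeDimension n f] (c : CoordinateChart f n)
    {x x' : Points f 𝒪[K]} (h : x.MemOpen c.U.1) (h' : x'.MemOpen c.U.1)
    (hred : x.reduce 𝓀[K] = x'.reduce 𝓀[K])
    (hu : ∀ i, x.eval h (c.u i) = x'.eval h' (c.u i)) : x = x' :=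
  c.point_ext (Algebra.ofId 𝒪[K] 𝓀[K]) (by rw [ker_ofId_residue]; exact iInf_maximalIdeal_pow)
    h h' hred hu

theorem reduce_eq_reduce_iff [SmoothOfRelativeDimension n f] (c : CoordinateChart f n)
    {x x' : Points f 𝒪[K]} (h : x.MemOpen c.U.1) (h' : x'.MemOpen c.U.1)
    (hred : x.reduce 𝓀[K] = x'.reduce 𝓀[K]) (k : ℕ) :
    x.reduce (𝒪[K] ⧸ 𝓂[K] ^ (k + 1)) = x'.reduce (𝒪[K] ⧸ 𝓂[K] ^ (k + 1)) ↔
      ∀ i, x.eval h (c.u i) - x'.eval h' (c.u i) ∈ 𝓂[K] ^ (k + 1) := by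
  simp_rw [← Ideal.Quotient.eq]
  have key (z : Points f 𝒪[K]) (hz : z.MemOpen c.U.1) (i : Fin n) :
      Ideal.Quotient.mk (𝓂[K] ^ (k + 1)) (z.eval hz (c.u i)) =
        (z.reduce (𝒪[K] ⧸ 𝓂[K] ^ (k + 1))).eval hz.reduce (c.u i) :=
    (Points.eval_reduce hz hz.reduce _).symm
  simp_rw [key]
  constructor
  · intro he i
    congr! 2
  · intro hu
    refine c.point_ext (quotientToResidue K k) (iInf_ker_quotientToResidue_pow k)
      h.reduce h'.reduce ?_ hu
    rw [Points.map_quotientToResidue, Points.map_quotientToResidue, hred]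

end CoordinateChart

variable (n) in
-- Lift the coordinates of `z` arbitrarily to `𝒪`, take the integral point with these coordinates
-- over the residue point of `z`, and use uniqueness over `𝒪/𝔪ᵏ⁺¹` to see that it reduces to `z`.
theorem Points.surjective_reduce [SmoothOfRelativeDimension n f] (k : ℕ) :
    Function.Surjective
      (Points.reduce (𝒪[K] ⧸ 𝓂[K] ^ (k + 1)) : Points f 𝒪[K] → Points f _) := by
  intro z
  obtain ⟨c, hc⟩ := CoordinateChart.exists_memOpen (n := n) z
  have hy := (z.memOpen_map_quotientToResidue _).mpr hc
  choose v hv using fun i => Ideal.Quotient.mk_surjective (z.eval hc (c.u i))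
  obtain ⟨x, h, hxy, hxv⟩ := c.exists_integral_point (z.map (quotientToResidue K k)) hy v
    fun i => by rw [← quotientToResidue_mk k, hv, Points.eval_map hc]
  refine ⟨x, c.point_ext (quotientToResidue K k) (iInf_ker_quotientToResidue_pow k)
    h.reduce hc ?_ fun i => ?_⟩
  · rw [Points.map_quotientToResidue, hxy]
  · rw [Points.eval_reduce h, hxv, ← hv]
    rfl

theorem vanishesAt_reduce_iff {r : ℕ} (α : PluricanonicalForms f n r) (c : CoordinateChart f n)
    {x : Points f 𝒪[K]} (h : x.MemOpen c.U.1) {a : Γ(X, c.U.1)} (ha : α.1 c.U = a • c.duPow r)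
    (k : ℕ) : VanishesAt α (x.reduce (𝒪[K] ⧸ 𝓂[K] ^ (k + 1))) ↔
      x.eval h a ∈ 𝓂[K] ^ (k + 1) := by
  rw [vanishesAt_iff α _ c h.reduce ha, Points.eval_reduce h]
  exact Ideal.Quotient.eq_zero_iff_mem

end LocalFieldPoints

/-! ### Cylinders generate the topology and the Borel sets -/

section Topology

variable {K : Type u} [Field K] [ValuativeRel K] [TopologicalSpace K]
  [IsNonarchimedeanLocalField K] {X : Scheme.{u}} {f : X ⟶ Spec (.of 𝒪[K])} {n : ℕ}

theorem Points.reduce_residue_eq {x x' : Points f 𝒪[K]} {k : ℕ}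
    (h : x.reduce (𝒪[K] ⧸ 𝓂[K] ^ (k + 1)) = x'.reduce (𝒪[K] ⧸ 𝓂[K] ^ (k + 1))) :
    x.reduce 𝓀[K] = x'.reduce 𝓀[K] := by
  rw [← Points.map_quotientToResidue x k, h, Points.map_quotientToResidue]

theorem Points.MemOpen.of_reduce_eq {x x' : Points f 𝒪[K]} {U : X.Opens} (h : x.MemOpen U)
    (hred : x.reduce 𝓀[K] = x'.reduce 𝓀[K]) : x'.MemOpen U := by
  rwa [← Points.memOpen_reduce_residue, ← hred, Points.memOpen_reduce_residue]

theorem Points.eval_sub_mem {x x' : Points f 𝒪[K]} {U : X.Opens} (h : x.MemOpen U)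
    (h' : x'.MemOpen U) {k : ℕ}
    (hred : x.reduce (𝒪[K] ⧸ 𝓂[K] ^ (k + 1)) = x'.reduce (𝒪[K] ⧸ 𝓂[K] ^ (k + 1)))
    (g : Γ(X, U)) : x.eval h g - x'.eval h' g ∈ 𝓂[K] ^ (k + 1) := by
  rw [← Ideal.Quotient.eq]
  refine (Points.eval_reduce h h.reduce g).symm.trans
    (Eq.trans ?_ (Points.eval_reduce h' h'.reduce g))
  congr! 2

variable (f) in
/-- The set of points with a given reduction modulo `𝔪ᵏ⁺¹`. -/
def cylinder (k : ℕ) (z : Points f (𝒪[K] ⧸ 𝓂[K] ^ (k + 1))) : Set (Points f 𝒪[K]) :=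
  {x | x.reduce _ = z}

variable (n) in
-- On an affine open, the reduction is fixed by the values modulo `𝔪ᵏ⁺¹` of finitely many algebra
-- generators, and each such congruence is an open condition.
theorem isOpen_cylinder [SmoothOfRelativeDimension n f] (k : ℕ)
    (z : Points f (𝒪[K] ⧸ 𝓂[K] ^ (k + 1))) : IsOpen (cylinder f k z) := by
  obtain ⟨x₀, rfl⟩ := Points.surjective_reduce n k z
  obtain ⟨U, hU⟩ := x₀.exists_affine_memOpen
  let := sectionsAlgebra f U.1
  have := finiteType_sections (n := n) (f := f) U
  obtain ⟨t, ht⟩ := Algebra.FiniteType.out (R := 𝒪[K]) (A := Γ(X, U.1))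
  have hsub (g : Γ(X, U.1)) (V : Set 𝒪[K]) (hV : IsOpen V) :
      IsOpen {x : Points f 𝒪[K] | ∃ h : x.MemOpen U.1, x.eval h g ∈ V} :=
    TopologicalSpace.isOpen_generateFrom_of_mem ⟨U, g, V, hV, rfl⟩
  -- The first set, with the function `0` and no condition on its value, only says that `x` lies in
  -- `U`; it matters when `t` is empty.
  have heq : cylinder f k (x₀.reduce _) =
      {x : Points f 𝒪[K] | ∃ h : x.MemOpen U.1, x.eval h 0 ∈ Set.univ} ∩
        ⋂ g ∈ t, {x : Points f 𝒪[K] | ∃ h : x.MemOpen U.1,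
          x.eval h g ∈ {b : 𝒪[K] | b - x₀.eval hU g ∈ 𝓂[K] ^ (k + 1)}} := by
    ext x
    constructor
    · intro hx
      have h : x.MemOpen U.1 := hU.of_reduce_eq (Points.reduce_residue_eq hx.symm)
      exact ⟨⟨h, trivial⟩, Set.mem_iInter₂.mpr fun g _ => ⟨h, Points.eval_sub_mem h hU hx g⟩⟩
    · rintro ⟨⟨h, -⟩, hx⟩
      let φ (x : Points f 𝒪[K]) (h : x.MemOpen U.1) : Γ(X, U.1) →ₐ[𝒪[K]] _ :=
        ⟨(x.reduce (𝒪[K] ⧸ 𝓂[K] ^ (k + 1))).eval h.reduce, Points.eval_toSections _ h.reduce⟩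
      have hφ : φ x h = φ x₀ hU := AlgHom.ext_of_adjoin_eq_top ht fun g hg => by
        obtain ⟨h', hg⟩ := Set.mem_iInter₂.mp hx g hg
        exact (Points.eval_reduce h h.reduce g).trans
          ((Ideal.Quotient.eq.mpr hg).trans (Points.eval_reduce hU hU.reduce g).symm)
      exact Points.ext_of_eval U.2 h.reduce hU.reduce fun g =>
        congrArg (fun ψ : Γ(X, U.1) →ₐ[𝒪[K]] _ => ψ g) hφ
  rw [heq]
  refine (hsub 0 _ isOpen_univ).inter (t.finite_toSet.isOpen_biInter fun g _ => hsub g _ ?_)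
  exact (isOpen_maximalIdeal_pow (K := K) (k + 1)).preimage (continuous_id.sub continuous_const)

/-- For a subbasic set this is continuity of one function value. Finite intersections are handled by
passing to the larger level, cylinders around `x` being nested. -/
theorem exists_cylinder_subset {s : Set (Points f 𝒪[K])} (hs : IsOpen s) {x : Points f 𝒪[K]}
    (hx : x ∈ s) : ∃ k, cylinder f k (x.reduce _) ⊆ s := by
  induction hs with
  | basic s hs =>
    obtain ⟨U, g, V, hV, rfl⟩ := hs
    obtain ⟨h, hg⟩ := hx
    obtain ⟨k, hk⟩ := exists_pow_subset_of_isOpen hV hg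
    refine ⟨k, fun x' hx' => ?_⟩
    have h' := h.of_reduce_eq (Points.reduce_residue_eq hx'.symm)
    exact ⟨h', hk _ (Ideal.pow_le_pow_right k.le_succ (Points.eval_sub_mem h' h hx' g))⟩
  | univ => exact ⟨0, Set.subset_univ _⟩
  | inter s t _ _ ihs iht =>
    obtain ⟨j, hj⟩ := ihs hx.1
    obtain ⟨k, hk⟩ := iht hx.2
    exact ⟨max j k, fun x' hx' => ⟨hj (Points.reduce_eq_of_le (le_max_left _ _) hx'),
      hk (Points.reduce_eq_of_le (le_max_right _ _) hx')⟩⟩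
  | sUnion S _ ih =>
    obtain ⟨s, hs, hxs⟩ := hx
    obtain ⟨k, hk⟩ := ih s hs hxs
    exact ⟨k, hk.trans (Set.subset_sUnion_of_mem hs)⟩

variable (f) in
/-- The family of all cylinders. -/
def cylinders : Set (Set (Points f 𝒪[K])) := {s | ∃ k z, s = cylinder f k z}

variable (n) in
-- The cylinders form a basis, countable because each level has finitely many.
theorem borel_eq_generateFrom_cylinders [SmoothOfRelativeDimension n f] [CompactSpace X] :
    borel (Points f 𝒪[K]) = MeasurableSpace.generateFrom (cylinders f) := by
  have hb : TopologicalSpace.IsTopologicalBasis (cylinders f) := by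
    refine TopologicalSpace.isTopologicalBasis_of_isOpen_of_nhds ?_ fun x s hx hs => ?_
    · rintro _ ⟨k, z, rfl⟩
      exact isOpen_cylinder n k z
    · obtain ⟨k, hk⟩ := exists_cylinder_subset hs hx
      exact ⟨_, ⟨k, _, rfl⟩, rfl, hk⟩
  have hc : (cylinders f).Countable := by
    have : cylinders f = ⋃ k, Set.range (cylinder f k) := by
      ext s
      simp [cylinders, eq_comm]
    rw [this]
    refine Set.countable_iUnion fun k => ?_
    have : Finite (Points f (𝒪[K] ⧸ 𝓂[K] ^ (k + 1))) := finite_points (n := n)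
    exact Set.countable_range _
  have := hb.secondCountableTopology hc
  exact borel_eq_generateFrom_of_subbasis hb.eq_generateFrom

theorem isPiSystem_cylinders : IsPiSystem (cylinders f) := by
  rintro _ ⟨j, z, rfl⟩ _ ⟨k, z', rfl⟩ ⟨x, hx, hx'⟩
  obtain rfl : x.reduce _ = z := hx
  obtain rfl : x.reduce _ = z' := hx'
  rcases le_total j k with h | h
  · refine ⟨k, x.reduce _, Set.inter_eq_right.mpr fun x' hx' => ?_⟩
    exact Points.reduce_eq_of_le h hx'
  · refine ⟨j, x.reduce _, Set.inter_eq_left.mpr fun x' hx' => ?_⟩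
    exact Points.reduce_eq_of_le h hx'

variable (n) in
theorem measurableSet_cylinder [SmoothOfRelativeDimension n f] (k : ℕ)
    (z : Points f (𝒪[K] ⧸ 𝓂[K] ^ (k + 1))) : MeasurableSet (cylinder f k z) :=
  (isOpen_cylinder n k z).measurableSet

variable (n) in
theorem measurableSet_preimage_reduce [SmoothOfRelativeDimension n f] [CompactSpace X] (k : ℕ)
    (A : Set (Points f (𝒪[K] ⧸ 𝓂[K] ^ (k + 1)))) :
    MeasurableSet {x : Points f 𝒪[K] | x.reduce _ ∈ A} := by
  have : Finite (Points f (𝒪[K] ⧸ 𝓂[K] ^ (k + 1))) := finite_points (n := n)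
  have h : {x : Points f 𝒪[K] | x.reduce _ ∈ A} = ⋃ z ∈ A, cylinder f k z := by
    ext x
    simp [cylinder]
  rw [h]
  exact A.toFinite.measurableSet_biUnion fun z _ => measurableSet_cylinder n k z

/-- The coordinates, in a chart, of the points of a set that reduce to a point `y`. -/
def CoordinateChart.coordImage (c : CoordinateChart f n) (y : Points f 𝓀[K])
    (s : Set (Points f 𝒪[K])) : Set (Fin n → K) :=
  {v | ∃ x ∈ s, x.reduce 𝓀[K] = y ∧ ∃ h : x.MemOpen c.U.1, c.coord x h = v}

namespace CoordinateChart

variable (c : CoordinateChart f n)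

theorem coordImage_iUnion {y : Points f 𝓀[K]} (s : ℕ → Set (Points f 𝒪[K])) :
    c.coordImage y (⋃ k, s k) = ⋃ k, c.coordImage y (s k) := by
  ext v
  simp only [coordImage, Set.mem_iUnion, Set.mem_ofPred_eq]
  constructor
  · rintro ⟨x, ⟨k, hk⟩, h⟩
    exact ⟨k, x, hk, h⟩
  · rintro ⟨k, x, hk, h⟩
    exact ⟨x, ⟨k, hk⟩, h⟩

theorem coordImage_cylinder_of_ne {k : ℕ} {z : Points f (𝒪[K] ⧸ 𝓂[K] ^ (k + 1))}
    {y : Points f 𝓀[K]} (h : z.map (quotientToResidue K k) ≠ y) :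
    c.coordImage y (cylinder f k z) = ∅ := by
  refine Set.eq_empty_of_forall_notMem ?_
  rintro v ⟨x, rfl, hy, -⟩
  exact h ((x.map_quotientToResidue k).trans hy)

variable [SmoothOfRelativeDimension n f]

/-- Hensel's lemma realizes each vector of the box by an integral point over the given residue
point, and congruent coordinates there force equal reductions. -/
theorem coordImage_cylinder {x₀ : Points f 𝒪[K]} (h₀ : x₀.MemOpen c.U.1) (k : ℕ) :
    c.coordImage (x₀.reduce 𝓀[K]) (cylinder f k (x₀.reduce _)) =
      Set.pi Set.univ fun i => intBall K (x₀.eval h₀ (c.u i)) (k + 1) := by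
  ext v
  constructor
  · rintro ⟨x, hx, hy, h, rfl⟩ i -
    exact ⟨_, Points.eval_sub_mem h h₀ hx _, rfl⟩
  · intro hv
    choose w hw hwv using fun i => hv i trivial
    have hy : (x₀.reduce 𝓀[K]).MemOpen c.U.1 := h₀.reduce
    obtain ⟨x, h, hxy, hxw⟩ := c.exists_integral_point (x₀.reduce 𝓀[K]) hy w fun i => by
      rw [Points.eval_reduce h₀, ← sub_eq_zero, ← map_sub]
      exact (IsLocalRing.residue_eq_zero_iff _).mpr (Ideal.pow_le_self k.succ_ne_zero (hw i))
    refine ⟨x, (c.reduce_eq_reduce_iff h h₀ hxy k).mpr fun i => ?_, hxy, h, ?_⟩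
    · rw [hxw]
      exact hw i
    · ext i
      rw [← hwv, ← hxw]
      rfl

theorem coordImage_injective (y : Points f 𝓀[K]) {x x' : Points f 𝒪[K]}
    (hx : x.reduce 𝓀[K] = y) (hx' : x'.reduce 𝓀[K] = y) (h : x.MemOpen c.U.1)
    (h' : x'.MemOpen c.U.1) (he : c.coord x h = c.coord x' h') : x = x' :=
  c.integral_point_ext h h' (hx.trans hx'.symm) fun i => Subtype.ext (congrFun he i)

theorem coordImage_compl {y : Points f 𝓀[K]} (s : Set (Points f 𝒪[K])) :
    c.coordImage y sᶜ = c.coordImage y Set.univ \ c.coordImage y s := by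
  ext v
  constructor
  · rintro ⟨x, hx, hy, h, rfl⟩
    refine ⟨⟨x, trivial, hy, h, rfl⟩, ?_⟩
    rintro ⟨x', hx', hy', h', he⟩
    exact hx (c.coordImage_injective y hy' hy h' h he ▸ hx')
  · rintro ⟨⟨x, -, hy, h, rfl⟩, hv⟩
    exact ⟨x, fun hx => hv ⟨x, hx, hy, h, rfl⟩, hy, h, rfl⟩

end CoordinateChart

variable (n) in
-- `𝒪/𝔪¹` and the residue field are distinct types, so the level `k = 0` has to be compared with
-- reduction to the residue field.
theorem Points.reduce_one_eq_iff [SmoothOfRelativeDimension n f] {x x' : Points f 𝒪[K]} :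
    x.reduce (𝒪[K] ⧸ 𝓂[K] ^ (0 + 1)) = x'.reduce (𝒪[K] ⧸ 𝓂[K] ^ (0 + 1)) ↔
      x.reduce 𝓀[K] = x'.reduce 𝓀[K] := by
  refine ⟨Points.reduce_residue_eq, fun hred => ?_⟩
  obtain ⟨c, h⟩ := CoordinateChart.exists_memOpen (n := n) x
  have h' := h.of_reduce_eq hred
  refine (c.reduce_eq_reduce_iff h h' hred 0).mpr fun i => ?_
  rw [zero_add, pow_one]
  refine (IsLocalRing.residue_eq_zero_iff _).mp ?_
  rw [map_sub, sub_eq_zero]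
  refine (Points.eval_reduce h h.reduce _).symm.trans
    (Eq.trans ?_ (Points.eval_reduce h' h'.reduce _))
  congr! 2

end Topology

/-! ### Existence and values of the canonical measure -/

section CanonicalMeasure

variable {K : Type u} [Field K] [ValuativeRel K] [TopologicalSpace K]
  [IsNonarchimedeanLocalField K] [MeasurableSpace K] [BorelSpace K] {X : Scheme.{u}}
  {f : X ⟶ Spec (.of 𝒪[K])} {n : ℕ} [SmoothOfRelativeDimension n f]

namespace CoordinateChart

variable (c : CoordinateChart f n)

/-- Induction over the σ-algebra generated by cylinders, whose images are empty or boxes.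
Complements are taken inside the image of the whole fibre, which uses that coordinates are injective
on it. -/
theorem measurableSet_coordImage [CompactSpace X] {y : Points f 𝓀[K]} (hy : y.MemOpen c.U.1)
    {s : Set (Points f 𝒪[K])} (hs : MeasurableSet s) : MeasurableSet (c.coordImage y s) := by
  have hcyl (k : ℕ) (z : Points f (𝒪[K] ⧸ 𝓂[K] ^ (k + 1))) :
      MeasurableSet (c.coordImage y (cylinder f k z)) := by
    by_cases hz : z.map (quotientToResidue K k) = y
    · obtain ⟨x₀, rfl⟩ := Points.surjective_reduce n k z
      rw [Points.map_quotientToResidue] at hz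
      subst hz
      rw [c.coordImage_cylinder ((x₀.memOpen_reduce_residue _).mp hy)]
      exact MeasurableSet.univ_pi fun i => measurableSet_intBall _ _
    · rw [c.coordImage_cylinder_of_ne hz]
      exact MeasurableSet.empty
  have huniv : MeasurableSet (c.coordImage y Set.univ) := by
    have : c.coordImage y Set.univ = ⋃ z, c.coordImage y (cylinder f 0 z) := by
      ext v
      constructor
      · rintro ⟨x, -, h⟩
        exact Set.mem_iUnion.mpr ⟨_, x, rfl, h⟩
      · intro hv
        obtain ⟨z, x, -, h⟩ := Set.mem_iUnion.mp hv
        exact ⟨x, trivial, h⟩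
    have : Finite (Points f (𝒪[K] ⧸ 𝓂[K] ^ (0 + 1))) := finite_points (n := n)
    rw [‹c.coordImage y Set.univ = _›]
    exact MeasurableSet.iUnion fun z => hcyl 0 z
  rw [BorelSpace.measurable_eq (α := Points f 𝒪[K]), borel_eq_generateFrom_cylinders n] at hs
  induction s, hs using MeasurableSpace.generateFrom_induction with
  | hC s hs =>
    obtain ⟨k, z, rfl⟩ := hs
    exact hcyl k z
  | empty => simp [coordImage]
  | compl s _ ih => rw [c.coordImage_compl]; exact huniv.diff ih
  | iUnion s _ ih => rw [c.coordImage_iUnion]; exact MeasurableSet.iUnion ih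

/-- The measure on the fibre of the reduction map over `y` given by the coordinates of a chart. -/
noncomputable def fibreMeasure [CompactSpace X] {y : Points f 𝓀[K]} (hy : y.MemOpen c.U.1) :
    Measure (Points f 𝒪[K]) :=
  Measure.ofMeasurable (fun s _ => haarPow K n (c.coordImage y s)) (by simp [coordImage])
    fun s hs hd => by
      rw [c.coordImage_iUnion, measure_iUnion ?_ fun k => c.measurableSet_coordImage hy (hs k)]
      intro i j hij
      refine Set.disjoint_left.mpr ?_
      rintro v ⟨x, hx, hxy, h, rfl⟩ ⟨x', hx', hxy', h', he⟩
      exact Set.disjoint_left.mp (hd hij) hx (c.coordImage_injective y hxy' hxy h' h he ▸ hx')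

theorem fibreMeasure_apply [CompactSpace X] {y : Points f 𝓀[K]} (hy : y.MemOpen c.U.1)
    {s : Set (Points f 𝒪[K])} (hs : MeasurableSet s) :
    c.fibreMeasure hy s = haarPow K n (c.coordImage y s) :=
  Measure.ofMeasurable_apply s hs

theorem fibreMeasure_cylinder [CompactSpace X] {y : Points f 𝓀[K]} (hy : y.MemOpen c.U.1) {k : ℕ}
    {z : Points f (𝒪[K] ⧸ 𝓂[K] ^ (k + 1))} (hz : z.map (quotientToResidue K k) = y) :
    c.fibreMeasure hy (cylinder f k z) = ((residueCard K : ENNReal) ^ ((k + 1) * n))⁻¹ := by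
  rw [fibreMeasure_apply c hy (measurableSet_cylinder n k z)]
  obtain ⟨x₀, rfl⟩ := Points.surjective_reduce n k z
  rw [Points.map_quotientToResidue] at hz
  subst hz
  rw [c.coordImage_cylinder ((x₀.memOpen_reduce_residue _).mp hy), haarPow_pi_intBall]

theorem fibreMeasure_cylinder_of_ne [CompactSpace X] {y : Points f 𝓀[K]} (hy : y.MemOpen c.U.1)
    {k : ℕ} {z : Points f (𝒪[K] ⧸ 𝓂[K] ^ (k + 1))} (hz : z.map (quotientToResidue K k) ≠ y) :
    c.fibreMeasure hy (cylinder f k z) = 0 := by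
  rw [fibreMeasure_apply c hy (measurableSet_cylinder n k z), c.coordImage_cylinder_of_ne hz,
    measure_empty]

theorem isFiniteMeasure_fibreMeasure [CompactSpace X] {y : Points f 𝓀[K]}
    (hy : y.MemOpen c.U.1) : IsFiniteMeasure (c.fibreMeasure hy) := by
  constructor
  have : Finite (Points f (𝒪[K] ⧸ 𝓂[K] ^ (0 + 1))) := finite_points (n := n)
  let := Fintype.ofFinite (Points f (𝒪[K] ⧸ 𝓂[K] ^ (0 + 1)))
  have huniv : (Set.univ : Set (Points f 𝒪[K])) = ⋃ z ∈ Finset.univ, cylinder f 0 z :=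
    (Set.eq_univ_of_forall fun x => Set.mem_iUnion₂.mpr ⟨_, Finset.mem_univ _, rfl⟩).symm
  rw [huniv]
  refine (measure_biUnion_finset_le _ _).trans_lt (ENNReal.sum_lt_top.mpr fun z _ => ?_)
  by_cases hz : z.map (quotientToResidue K 0) = y
  · rw [c.fibreMeasure_cylinder hy hz]
    exact ENNReal.inv_lt_top.mpr (ENNReal.pow_pos (Nat.cast_pos.mpr Nat.card_pos) _)
  · rw [c.fibreMeasure_cylinder_of_ne hy hz]
    exact ENNReal.zero_lt_top

/-- Both measures give `q^(-(k+1)n)` to each cylinder over `y` and `0` to the others, and cylinders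
are a generating π-system. This takes the place of a change of variables between charts. -/
theorem fibreMeasure_eq [CompactSpace X] (c' : CoordinateChart f n) {y : Points f 𝓀[K]}
    (hy : y.MemOpen c.U.1) (hy' : y.MemOpen c'.U.1) : c.fibreMeasure hy = c'.fibreMeasure hy' := by
  have hcyl (k : ℕ) (z : Points f (𝒪[K] ⧸ 𝓂[K] ^ (k + 1))) :
      c.fibreMeasure hy (cylinder f k z) = c'.fibreMeasure hy' (cylinder f k z) := by
    by_cases hz : z.map (quotientToResidue K k) = y
    · rw [c.fibreMeasure_cylinder hy hz, c'.fibreMeasure_cylinder hy' hz]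
    · rw [c.fibreMeasure_cylinder_of_ne hy hz, c'.fibreMeasure_cylinder_of_ne hy' hz]
  have := c.isFiniteMeasure_fibreMeasure hy
  have : Finite (Points f (𝒪[K] ⧸ 𝓂[K] ^ (0 + 1))) := finite_points (n := n)
  have huniv : (Set.univ : Set (Points f 𝒪[K])) = ⋃ z, cylinder f 0 z :=
    (Set.eq_univ_of_forall fun x => Set.mem_iUnion.mpr ⟨x.reduce _, rfl⟩).symm
  have hd : Pairwise (Function.onFun Disjoint (cylinder f 0)) := fun z z' hzz' =>
    Set.disjoint_left.mpr fun x hx hx' => hzz' (hx.symm.trans hx')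
  refine ext_of_generate_finite (cylinders f)
    ((BorelSpace.measurable_eq (α := Points f 𝒪[K])).trans (borel_eq_generateFrom_cylinders n))
    isPiSystem_cylinders ?_ ?_
  · rintro _ ⟨k, z, rfl⟩
    exact hcyl k z
  · rw [huniv, measure_iUnion hd fun z => measurableSet_cylinder n 0 z,
      measure_iUnion hd fun z => measurableSet_cylinder n 0 z]
    exact tsum_congr fun z => hcyl 0 z

end CoordinateChart

variable (f n) in
-- Sum the fibre measures over all residue points, using one chosen chart for each. Since
-- `canonicalMeasure` is defined by choice, existence is what gives it its property.
theorem exists_isCanonicalMeasure [CompactSpace X] :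
    ∃ μ : Measure (Points f 𝒪[K]), IsCanonicalMeasure f n μ := by
  choose c hc using fun y : Points f 𝓀[K] => CoordinateChart.exists_memOpen (n := n) y
  refine ⟨Measure.sum fun y => (c y).fibreMeasure (hc y), fun c' y hy s hs hsy => ?_⟩
  rw [Measure.sum_apply _ hs, tsum_eq_single y]
  · rw [(c y).fibreMeasure_eq c' (hc y) hy, c'.fibreMeasure_apply hy hs]
    congr 1
    ext v
    constructor
    · rintro ⟨x, hx, -, h⟩
      exact ⟨x, hx, h⟩
    · rintro ⟨x, hx, h⟩
      exact ⟨x, hx, hsy x hx, h⟩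
  · intro y' hy'
    rw [(c y').fibreMeasure_apply (hc y') hs]
    have : (c y').coordImage y' s = ∅ := by
      refine Set.eq_empty_of_forall_notMem ?_
      rintro v ⟨x, hx, hxy, -⟩
      exact hy' (hxy.symm.trans (hsy x hx))
    rw [this, measure_empty]

variable (f n) in
theorem isCanonicalMeasure_canonicalMeasure [CompactSpace X] :
    IsCanonicalMeasure f n (canonicalMeasure f n) :=
  Classical.epsilon_spec (exists_isCanonicalMeasure f n)

theorem canonicalMeasure_cylinder [CompactSpace X] {k : ℕ}
    (z : Points f (𝒪[K] ⧸ 𝓂[K] ^ (k + 1))) :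
    canonicalMeasure f n (cylinder f k z) = ((residueCard K : ENNReal) ^ ((k + 1) * n))⁻¹ := by
  obtain ⟨x₀, rfl⟩ := Points.surjective_reduce n k z
  obtain ⟨c, h₀⟩ := CoordinateChart.exists_memOpen (n := n) x₀
  rw [isCanonicalMeasure_canonicalMeasure f n c (x₀.reduce 𝓀[K]) h₀.reduce _
    (measurableSet_cylinder n k _) fun x hx => Points.reduce_residue_eq hx,
    ← haarPow_pi_intBall (fun i => x₀.eval h₀ (c.u i)) (k + 1), ← c.coordImage_cylinder h₀]
  congr 1
  ext v
  constructor
  · rintro ⟨x, hx, h⟩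
    exact ⟨x, hx, Points.reduce_residue_eq hx, h⟩
  · rintro ⟨x, hx, -, h⟩
    exact ⟨x, hx, h⟩

/-- The measure of a set of points defined by a condition modulo `𝔪ᵏ⁺¹`. -/
theorem canonicalMeasure_preimage_reduce [CompactSpace X] (k : ℕ)
    (A : Set (Points f (𝒪[K] ⧸ 𝓂[K] ^ (k + 1)))) :
    canonicalMeasure f n {x | x.reduce _ ∈ A} =
      Nat.card A * ((residueCard K : ENNReal) ^ ((k + 1) * n))⁻¹ := by
  have : Finite (Points f (𝒪[K] ⧸ 𝓂[K] ^ (k + 1))) := finite_points (n := n)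
  let := Fintype.ofFinite A
  have h : {x : Points f 𝒪[K] | x.reduce _ ∈ A} = ⋃ z : A, cylinder f k z := by
    ext x
    simp [cylinder]
  rw [h, measure_iUnion ?_ fun z : A => measurableSet_cylinder n k z.1]
  · simp_rw [canonicalMeasure_cylinder, tsum_fintype, Finset.sum_const, Finset.card_univ,
      nsmul_eq_mul, Nat.card_eq_fintype_card]
  · exact fun z z' hzz' => Set.disjoint_left.mpr fun x hx hx' =>
      hzz' (Subtype.ext (hx.symm.trans hx'))

end CanonicalMeasure

/-! ### Convergence of the series of zero counts -/

section ZeroCount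

variable {K : Type u} [Field K] [ValuativeRel K] [TopologicalSpace K]
  [IsNonarchimedeanLocalField K] {X : Scheme.{u}} [IsIntegral X]
  {f : X ⟶ Spec (.of 𝒪[K])} {n r : ℕ} [SmoothOfRelativeDimension n f]

/-- In a chart, the zeros of a nonzero form are among those of a nonzero polynomial in the
coordinates. -/
theorem CoordinateChart.exists_polynomial (c : CoordinateChart f n)
    {α : PluricanonicalForms f n r} (hα : α ≠ 0) {p : X} (hp : p ∈ c.U.1) :
    ∃ Q : MvPolynomial (Fin n) 𝒪[K], Q ≠ 0 ∧
      ∀ (k : ℕ) (z : Points f (𝒪[K] ⧸ 𝓂[K] ^ (k + 1))) (h : z.MemOpen c.U.1), VanishesAt α z →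
        MvPolynomial.aeval (fun i => z.eval h (c.u i)) Q = 0 := by
  let := sectionsAlgebra f c.U.1
  have := formallySmooth_sections (n := n) (f := f) c.U
  have := finiteType_sections (n := n) (f := f) c.U
  have := isDomain_sections hp
  obtain ⟨b, hb⟩ := c.isBasis
  obtain ⟨a, ha⟩ := c.exists_eq_smul_duPow (α.1 c.U)
  have ha0 : a ≠ 0 := by
    rintro rfl
    exact hα (eq_zero_of_eq_zero_on_chart α c hp (by rw [ha, zero_smul]))
  obtain ⟨Q, hQ, d, hd⟩ := exists_dvd_aeval_coordinates b hb ha0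
  refine ⟨Q, fun h => hQ (by rw [h, map_zero]), fun k z h hz => ?_⟩
  let g : Γ(X, c.U.1) →ₐ[𝒪[K]] 𝒪[K] ⧸ 𝓂[K] ^ (k + 1) := ⟨z.eval h, z.eval_toSections h⟩
  have hg : MvPolynomial.aeval (fun i => z.eval h (c.u i)) Q = g (MvPolynomial.aeval c.u Q) := by
    rw [← AlgHom.comp_apply, MvPolynomial.comp_aeval]
    rfl
  have h0 : g a = 0 := (vanishesAt_iff α z c h ha).mp hz
  rw [hg, hd, map_mul, h0, zero_mul]

/-- Choose a chart around each of the finitely many residue points `y`. Sending a zero of `α` to its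
residue point and its coordinates is injective, and the coordinates are a zero of the nonzero
polynomial `Q y`. -/
theorem summable_zeroCount [CompactSpace X] {α : PluricanonicalForms f n r} (hα : α ≠ 0) :
    Summable fun k : ℕ => (zeroCount α (k + 1) : ℝ) / (residueCard K : ℝ) ^ ((k + 1) * n) := by
  choose c hc using fun y : Points f 𝓀[K] => CoordinateChart.exists_memOpen (n := n) y
  choose Q hQ hQz using fun y : Points f 𝓀[K] =>
    (c y).exists_polynomial hα ((y.memOpen_iff_closedPoint _).mp (hc y))
  have : Finite (Points f 𝓀[K]) := finite_points (n := n)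
  let := Fintype.ofFinite (Points f 𝓀[K])
  have hsum : Summable fun k : ℕ => ∑ y, (Nat.card
      {v : Fin n → 𝒪[K] ⧸ 𝓂[K] ^ (k + 1) // MvPolynomial.aeval v (Q y) = 0} : ℝ) /
        (residueCard K : ℝ) ^ ((k + 1) * n) :=
    summable_sum fun y _ => (summable_nat_add_iff 1).mpr (summable_card_zeros (hQ y))
  refine hsum.of_nonneg_of_le (fun k => by positivity) fun k => ?_
  rw [← Finset.sum_div]
  gcongr
  let F : {z : Points f (𝒪[K] ⧸ 𝓂[K] ^ (k + 1)) // VanishesAt α z} →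
      Σ y, {v : Fin n → 𝒪[K] ⧸ 𝓂[K] ^ (k + 1) // MvPolynomial.aeval v (Q y) = 0} := fun z =>
    ⟨z.1.map (quotientToResidue K k), _,
      hQz _ k z.1 ((z.1.memOpen_map_quotientToResidue _).mp (hc _)) z.2⟩
  have hF : Function.Injective F := by
    rintro ⟨z, hz⟩ ⟨z', hz'⟩ h
    have key (y y' : Points f 𝓀[K]) (hy : z.map (quotientToResidue K k) = y)
        (hy' : z'.map (quotientToResidue K k) = y') (h : z.MemOpen (c y).U.1)
        (h' : z'.MemOpen (c y').U.1) (hQ₁ hQ₂)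
        (he : (⟨y, fun i => z.eval h ((c y).u i), hQ₁⟩ :
          Σ y, {v : Fin n → 𝒪[K] ⧸ 𝓂[K] ^ (k + 1) // MvPolynomial.aeval v (Q y) = 0}) =
          ⟨y', fun i => z'.eval h' ((c y').u i), hQ₂⟩) : z = z' := by
      obtain ⟨rfl, he⟩ := Sigma.mk.inj he
      exact (c y).point_ext (quotientToResidue K k) (iInf_ker_quotientToResidue_pow k) h h'
        (hy.trans hy'.symm) fun i => congrFun (congrArg Subtype.val (eq_of_heq he)) i
    exact Subtype.ext (key _ _ rfl rfl _ _ _ _ h)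
  have := Nat.card_le_card_of_injective F hF
  rw [Nat.card_sigma] at this
  exact_mod_cast this

end ZeroCount

/-! ### Integration over the level sets -/

section LevelSets

open Filter Topology

variable {Ω : Type*} {V : ℕ → Set Ω}

theorem sum_indicator_level (w : ℂ) {x : Ω} {m : ℕ} (hm : ∀ j, x ∈ V j ↔ j < m) (J : ℕ) :
    1 - (1 - w) * ∑ j ∈ Finset.range J, w ^ j * (V j).indicator (1 : Ω → ℂ) x =
      w ^ min J m := by
  have h : ∑ j ∈ Finset.range J, w ^ j * (V j).indicator (1 : Ω → ℂ) x =
      ∑ j ∈ Finset.range (min J m), w ^ j := by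
    rw [← Finset.sum_subset (Finset.range_subset_range.mpr (min_le_left J m))]
    · refine Finset.sum_congr rfl fun j hj => ?_
      have : x ∈ V j := (hm j).mpr (by grind)
      simp [this]
    · intro j hj hj'
      have : x ∉ V j := fun h => hj' (by have := (hm j).mp h; grind)
      simp [this]
  rw [h, mul_neg_geom_sum, sub_sub_cancel]

variable [MeasurableSpace Ω] {μ : Measure Ω} [IsFiniteMeasure μ]

/-- The points lying in all `V k` form a null set, because the measures of the `V k` tend to `0`. -/
theorem ae_exists_mem_iff_lt (hsum : Summable fun k => μ.real (V k))
    (hcase : ∀ x, (∀ k, x ∈ V k) ∨ ∃ m, ∀ j, x ∈ V j ↔ j < m) :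
    ∀ᵐ x ∂μ, ∃ m, ∀ j, x ∈ V j ↔ j < m := by
  have h0 : μ.real (⋂ k, V k) = 0 :=
    le_antisymm (ge_of_tendsto' hsum.tendsto_atTop_zero fun k =>
      measureReal_mono (Set.iInter_subset _ k)) measureReal_nonneg
  rw [measureReal_eq_zero_iff] at h0
  filter_upwards [measure_eq_zero_iff_ae_notMem.mp h0] with x hx
  exact (hcase x).resolve_left fun h => hx (Set.mem_iInter.mpr h)

/-- The integral of a function with values `wᵐ` on the differences `Vₘ₋₁ \ Vₘ`. -/
theorem integral_pow_level (hV : ∀ k, MeasurableSet (V k))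
    (hsum : Summable fun k => μ.real (V k))
    (hcase : ∀ x, (∀ k, x ∈ V k) ∨ ∃ m, ∀ j, x ∈ V j ↔ j < m) {w : ℂ} (hw : ‖w‖ ≤ 1) {F : Ω → ℂ}
    (hF : ∀ x m, (∀ j, x ∈ V j ↔ j < m) → F x = w ^ m) :
    Integrable F μ ∧ (Summable fun k => w ^ k * (μ.real (V k) : ℂ)) ∧
      ∫ x, F x ∂μ = μ.real Set.univ - (1 - w) * ∑' k, w ^ k * (μ.real (V k) : ℂ) := by
  -- At a point of level `m` the truncation `G J` equals `w ^ min J m`. It is bounded by `1` and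
  -- eventually equal to `F x`, so dominated convergence applies even when `‖w‖ = 1`.
  let G (J : ℕ) (x : Ω) : ℂ :=
    1 - (1 - w) * ∑ j ∈ Finset.range J, w ^ j * (V j).indicator (1 : Ω → ℂ) x
  have hae := ae_exists_mem_iff_lt hsum hcase
  have hind (j : ℕ) : Integrable ((V j).indicator (1 : Ω → ℂ)) μ :=
    (integrable_const (1 : ℂ)).indicator (hV j)
  have hterm (j : ℕ) : Integrable (fun x => w ^ j * (V j).indicator (1 : Ω → ℂ) x) μ :=
    (hind j).const_mul _
  have hsumI (J : ℕ) : Integrable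
      (fun x => ∑ j ∈ Finset.range J, w ^ j * (V j).indicator (1 : Ω → ℂ) x) μ :=
    integrable_finsetSum _ fun j _ => hterm j
  have hGI (J : ℕ) : Integrable (G J) μ := (integrable_const 1).sub ((hsumI J).const_mul _)
  have hlim : ∀ᵐ x ∂μ, Tendsto (fun J => G J x) atTop (𝓝 (F x)) := by
    filter_upwards [hae] with x ⟨m, hm⟩
    refine tendsto_const_nhds.congr' ?_
    filter_upwards [eventually_ge_atTop m] with J hJ
    rw [hF x m hm, ← min_eq_right hJ]
    exact (sum_indicator_level w hm J).symm
  have hbound (J : ℕ) : ∀ᵐ x ∂μ, ‖G J x‖ ≤ 1 := by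
    filter_upwards [hae] with x ⟨m, hm⟩
    simp only [G]
    rw [sum_indicator_level w hm J, norm_pow]
    exact pow_le_one₀ (norm_nonneg w) hw
  have hFb : ∀ᵐ x ∂μ, ‖F x‖ ≤ 1 := by
    filter_upwards [hae] with x ⟨m, hm⟩
    rw [hF x m hm, norm_pow]
    exact pow_le_one₀ (norm_nonneg w) hw
  have hFI : Integrable F μ := Integrable.of_bound
    (aestronglyMeasurable_of_tendsto_ae atTop (fun J => (hGI J).aestronglyMeasurable) hlim) 1 hFb
  have hS : Summable fun k => w ^ k * (μ.real (V k) : ℂ) := by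
    refine hsum.of_norm_bounded fun k => ?_
    rw [norm_mul, norm_pow, Complex.norm_real, Real.norm_of_nonneg measureReal_nonneg]
    exact mul_le_of_le_one_left measureReal_nonneg (pow_le_one₀ (norm_nonneg w) hw)
  refine ⟨hFI, hS, ?_⟩
  have hGint (J : ℕ) : ∫ x, G J x ∂μ =
      μ.real Set.univ - (1 - w) * ∑ j ∈ Finset.range J, w ^ j * (μ.real (V j) : ℂ) := by
    simp only [G]
    rw [integral_sub (integrable_const 1) ((hsumI J).const_mul _), integral_const_mul,
      integral_finsetSum _ fun j _ => hterm j]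
    have h (j : ℕ) : ∫ x, w ^ j * (V j).indicator (1 : Ω → ℂ) x ∂μ = w ^ j * (μ.real (V j) : ℂ) := by
      rw [integral_const_mul, integral_indicator (hV j)]
      simp
    simp_rw [h]
    simp
  refine tendsto_nhds_unique (tendsto_integral_of_dominated_convergence (fun _ => 1)
    (fun J => (hGI J).aestronglyMeasurable) (integrable_const 1) hbound hlim) ?_
  simp_rw [hGint]
  exact tendsto_const_nhds.sub (hS.hasSum.tendsto_sum_nat.const_mul _)

end LevelSets

/-! ### The density of the form and its level sets -/

section Density

variable {K : Type u} [Field K] [ValuativeRel K] [TopologicalSpace K]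
  [IsNonarchimedeanLocalField K]

theorem eq_zero_or_exists_mem_pow_iff (a : 𝒪[K]) :
    a = 0 ∨ ∃ m, ∀ k, a ∈ 𝓂[K] ^ k ↔ k ≤ m := by
  classical
  refine or_iff_not_imp_left.mpr fun ha => ?_
  have h : ∃ k, a ∉ 𝓂[K] ^ k := by
    by_contra! h
    have h0 : a ∈ ⨅ k : ℕ, 𝓂[K] ^ k := (Submodule.mem_iInf _).mpr h
    rw [iInf_maximalIdeal_pow, Ideal.mem_bot] at h0
    exact ha h0
  have hpos : Nat.find h ≠ 0 := fun h0 => by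
    have := Nat.find_spec h
    simp [h0] at this
  refine ⟨Nat.find h - 1, fun k => ⟨fun hk => ?_, fun hk => ?_⟩⟩
  · by_contra! hlt
    exact Nat.find_spec h (Ideal.pow_le_pow_right (by lia) hk)
  · exact not_not.mp (Nat.find_min h (by lia))

theorem normAbs_of_mem_pow_iff {a : 𝒪[K]} {m : ℕ} (h : ∀ k, a ∈ 𝓂[K] ^ k ↔ k ≤ m) :
    normAbs (a : K) = ((residueCard K : ℝ) ^ m)⁻¹ :=
  normAbs_coe ((h m).mpr le_rfl) fun h' => absurd ((h _).mp h') (by lia)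

/-- Vanishing modulo `𝔪ᵏ⁺¹` does not refer to a chart, so this makes the absolute value of the
coefficient, and hence the density, independent of the chart. -/
theorem normAbs_eq_of_forall_mem_iff {a b : 𝒪[K]}
    (h : ∀ k, a ∈ 𝓂[K] ^ (k + 1) ↔ b ∈ 𝓂[K] ^ (k + 1)) : normAbs (a : K) = normAbs (b : K) := by
  have h' (k : ℕ) : a ∈ 𝓂[K] ^ k ↔ b ∈ 𝓂[K] ^ k := by
    cases k with
    | zero => simp
    | succ k => exact h k
  rcases eq_zero_or_exists_mem_pow_iff a with rfl | ⟨m, hm⟩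
  · have h0 : b ∈ ⨅ k : ℕ, 𝓂[K] ^ k :=
      (Submodule.mem_iInf _).mpr fun k => (h' k).mp (zero_mem _)
    rw [iInf_maximalIdeal_pow, Ideal.mem_bot] at h0
    rw [h0]
  · rw [normAbs_of_mem_pow_iff hm, normAbs_of_mem_pow_iff fun k => (h' k).symm.trans (hm k)]

variable {X : Scheme.{u}} {f : X ⟶ Spec (.of 𝒪[K])} {n r : ℕ}

theorem isDensityAt_density [SmoothOfRelativeDimension n f] (α : PluricanonicalForms f n r)
    (x : Points f 𝒪[K]) : IsDensityAt α x (density α x) := by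
  refine Classical.epsilon_spec (p := IsDensityAt α x) ?_
  obtain ⟨c, h⟩ := CoordinateChart.exists_memOpen (n := n) x
  obtain ⟨a, ha⟩ := c.exists_eq_smul_duPow (α.1 c.U)
  refine ⟨normAbs ((x.eval h a : 𝒪[K]) : K), fun c' h' a' ha' => ?_⟩
  exact normAbs_eq_of_forall_mem_iff fun k =>
    (vanishesAt_reduce_iff α c h ha k).symm.trans (vanishesAt_reduce_iff α c' h' ha' k)

/-- The set of points at which the form vanishes modulo `𝔪ᵏ⁺¹`. -/
def zeroLocus (α : PluricanonicalForms f n r) (k : ℕ) : Set (Points f 𝒪[K]) :=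
  {x | x.reduce (𝒪[K] ⧸ 𝓂[K] ^ (k + 1)) ∈ {z | VanishesAt α z}}

theorem mem_zeroLocus_cases [SmoothOfRelativeDimension n f] (α : PluricanonicalForms f n r)
    (x : Points f 𝒪[K]) :
    (∀ k, x ∈ zeroLocus α k) ∨ ∃ m, ∀ j, x ∈ zeroLocus α j ↔ j < m := by
  obtain ⟨c, h⟩ := CoordinateChart.exists_memOpen (n := n) x
  obtain ⟨a, ha⟩ := c.exists_eq_smul_duPow (α.1 c.U)
  have key (k : ℕ) : x ∈ zeroLocus α k ↔ x.eval h a ∈ 𝓂[K] ^ (k + 1) :=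
    vanishesAt_reduce_iff α c h ha k
  rcases eq_zero_or_exists_mem_pow_iff (x.eval h a) with h0 | ⟨m, hm⟩
  · exact Or.inl fun k => (key k).mpr (h0 ▸ zero_mem _)
  · exact Or.inr ⟨m, fun j => (key j).trans (hm _)⟩

theorem density_of_mem_zeroLocus_iff [SmoothOfRelativeDimension n f]
    (α : PluricanonicalForms f n r) {x : Points f 𝒪[K]} {m : ℕ}
    (hm : ∀ j, x ∈ zeroLocus α j ↔ j < m) : density α x = ((residueCard K : ℝ) ^ m)⁻¹ := by
  obtain ⟨c, h⟩ := CoordinateChart.exists_memOpen (n := n) x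
  obtain ⟨a, ha⟩ := c.exists_eq_smul_duPow (α.1 c.U)
  rw [isDensityAt_density α x c h a ha]
  refine normAbs_of_mem_pow_iff fun k => ?_
  cases k with
  | zero => simp
  | succ k => exact (vanishesAt_reduce_iff α c h ha k).symm.trans (hm k)

theorem densityPow_of_mem_zeroLocus_iff [SmoothOfRelativeDimension n f]
    (α : PluricanonicalForms f n r) (s : ℂ) {x : Points f 𝒪[K]} {m : ℕ}
    (hm : ∀ j, x ∈ zeroLocus α j ↔ j < m) :
    densityPow α s x = (((residueCard K : ℂ) ^ s)⁻¹) ^ m := by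
  rw [densityPow, density_of_mem_zeroLocus_iff α hm]
  push_cast
  -- Inverting the base of a complex power requires its argument to differ from `π`; a natural
  -- number has argument `0`.
  rw [Complex.inv_cpow, ← Complex.natCast_cpow_natCast_mul, Complex.cpow_nat_mul, inv_pow]
  rw [← Nat.cast_pow, Complex.natCast_arg]
  exact Real.pi_pos.ne

theorem one_lt_residueCard : 1 < residueCard K := Finite.one_lt_card

theorem norm_inv_residueCard_cpow_le {s : ℂ} (hs : 0 ≤ s.re) :
    ‖((residueCard K : ℂ) ^ s)⁻¹‖ ≤ 1 := by
  rw [norm_inv, Complex.norm_natCast_cpow_of_pos (Nat.zero_lt_of_lt one_lt_residueCard)]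
  exact inv_le_one_of_one_le₀ (Real.one_le_rpow (by exact_mod_cast one_lt_residueCard.le) hs)

theorem card_points_quotient [SmoothOfRelativeDimension n f] :
    Nat.card (Points f (𝒪[K] ⧸ 𝓂[K] ^ (0 + 1))) = Nat.card (Points (specialFibre f) 𝓀[K]) := by
  refine (Nat.card_congr (Equiv.ofBijective (Points.map (quotientToResidue K 0)) ⟨?_, ?_⟩)).trans
    (Nat.card_congr (pointsPullbackEquiv (f := f) 𝓀[K])).symm
  · intro z z' h
    obtain ⟨x, rfl⟩ := Points.surjective_reduce n 0 z
    obtain ⟨x', rfl⟩ := Points.surjective_reduce n 0 z'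
    rw [Points.map_quotientToResidue, Points.map_quotientToResidue] at h
    exact (Points.reduce_one_eq_iff n).mpr h
  · intro y
    obtain ⟨c, hy⟩ := CoordinateChart.exists_memOpen (n := n) y
    choose v hv using fun i => IsLocalRing.residue_surjective (y.eval hy (c.u i))
    obtain ⟨x, -, hx, -⟩ := c.exists_integral_point y hy v hv
    exact ⟨x.reduce _, (x.map_quotientToResidue 0).trans hx⟩

variable [MeasurableSpace K] [BorelSpace K] [SmoothOfRelativeDimension n f] [CompactSpace X]

theorem measureReal_zeroLocus (α : PluricanonicalForms f n r) (k : ℕ) :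
    (canonicalMeasure f n).real (zeroLocus α k) =
      (zeroCount α (k + 1) : ℝ) / (residueCard K : ℝ) ^ ((k + 1) * n) := by
  rw [measureReal_def, zeroLocus, canonicalMeasure_preimage_reduce, ENNReal.toReal_mul,
    ENNReal.toReal_inv, ENNReal.toReal_pow, ENNReal.toReal_natCast, ENNReal.toReal_natCast]
  rfl

variable (f n) in
theorem canonicalMeasure_univ : canonicalMeasure f n Set.univ =
    Nat.card (Points (specialFibre f) 𝓀[K]) * ((residueCard K : ENNReal) ^ n)⁻¹ := by
  have := canonicalMeasure_preimage_reduce (n := n) 0 (Set.univ : Set (Points f _))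
  rw [Nat.card_univ, card_points_quotient (n := n), zero_add, one_mul] at this
  exact this

variable (f n) in
theorem isFiniteMeasure_canonicalMeasure : IsFiniteMeasure (canonicalMeasure f n) := by
  constructor
  rw [canonicalMeasure_univ]
  exact ENNReal.mul_lt_top (ENNReal.natCast_lt_top _) (ENNReal.inv_lt_top.mpr
    (ENNReal.pow_pos (Nat.cast_pos.mpr (Nat.zero_lt_of_lt one_lt_residueCard)) _))

end Density

end PluriForm

/-! ### The formula -/

theorem mainTheorem6 {K : Type u} [Field K] [ValuativeRel K] [TopologicalSpace K]
    [IsNonarchimedeanLocalField K] [CharZero K] [MeasurableSpace K] [BorelSpace K]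
    {X : Scheme.{u}} (f : X ⟶ Spec (.of 𝒪[K])) [IsIntegral X] (n : ℕ)
    [SmoothOfRelativeDimension n f] (hf : PluriForm.IsProjective f)
    (r : ℕ) (hr : 0 < r) (α : PluriForm.PluricanonicalForms f n r) (hα : α ≠ 0)
    (s : ℂ) (hs : 0 ≤ s.re) :
    Integrable (PluriForm.densityPow α s) (PluriForm.canonicalMeasure f n) ∧
    Summable (fun k : ℕ => (PluriForm.zeroCount α (k + 1) : ℂ) /
      (PluriForm.residueCard K : ℂ) ^ (((k + 1 : ℕ) : ℂ) * ((n : ℂ) + s))) ∧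
    PluriForm.sNorm α s =
      (Nat.card (PluriForm.Points (PluriForm.specialFibre f) 𝓀[K]) : ℂ) /
          (PluriForm.residueCard K : ℂ) ^ n -
        ((PluriForm.residueCard K : ℂ) ^ s - 1) *
          ∑' k : ℕ, (PluriForm.zeroCount α (k + 1) : ℂ) /
            (PluriForm.residueCard K : ℂ) ^ (((k + 1 : ℕ) : ℂ) * ((n : ℂ) + s)) := by
  have := hf.compactSpace
  have := PluriForm.isFiniteMeasure_canonicalMeasure f n
  have hq : (PluriForm.residueCard K : ℂ) ≠ 0 :=
    Nat.cast_ne_zero.mpr (Nat.zero_lt_of_lt PluriForm.one_lt_residueCard).ne'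
  set Q : ℂ := (PluriForm.residueCard K : ℂ) ^ s with hQ
  have hQ0 : Q ≠ 0 := by simp [hQ, Complex.cpow_eq_zero_iff, hq]
  obtain ⟨hint, hsum, heq⟩ := PluriForm.integral_pow_level
    (μ := PluriForm.canonicalMeasure f n) (V := PluriForm.zeroLocus α) (w := Q⁻¹)
    (F := PluriForm.densityPow α s)
    (fun k => PluriForm.measurableSet_preimage_reduce n k _)
    (by simpa only [PluriForm.measureReal_zeroLocus] using PluriForm.summable_zeroCount hα)
    (PluriForm.mem_zeroLocus_cases α) (PluriForm.norm_inv_residueCard_cpow_le hs)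
    fun x m hm => PluriForm.densityPow_of_mem_zeroLocus_iff α s hm
  -- `V k` concerns vanishing modulo `𝔪ᵏ⁺¹`, so the term for `N_(k+1)` carries one more factor `Q⁻¹`
  -- than the weight `Q⁻¹ ^ k`. This factor turns `1 - Q⁻¹` into `Q - 1`.
  have hterm (k : ℕ) : (PluriForm.zeroCount α (k + 1) : ℂ) /
      (PluriForm.residueCard K : ℂ) ^ (((k + 1 : ℕ) : ℂ) * ((n : ℂ) + s)) =
      Q⁻¹ * (Q⁻¹ ^ k * ((PluriForm.canonicalMeasure f n).real (PluriForm.zeroLocus α k) : ℂ)) := by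
    rw [PluriForm.measureReal_zeroLocus, Complex.cpow_nat_mul, Complex.cpow_add _ _ hq,
      Complex.cpow_natCast, mul_pow, ← pow_mul, mul_comm n, ← hQ, pow_succ Q,
      inv_pow]
    push_cast
    field_simp
  simp_rw [hterm]
  refine ⟨hint, hsum.mul_left _, heq.trans ?_⟩
  rw [tsum_mul_left, measureReal_def, PluriForm.canonicalMeasure_univ f n]
  simp only [ENNReal.toReal_mul, ENNReal.toReal_inv, ENNReal.toReal_pow, ENNReal.toReal_natCast]
  push_cast
  field_simp
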